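/- There are absolute constants $c, C > 0$ such that the following holds for all integers $n, k \ge 0$ and $s > 4$ and every real $\varepsilon > 0$. Let $f : \{-1,1\}^n \to \{0,1\}$ be computed by a DNF formula (an OR of terms, each term being an AND of literals) with at most $s$ terms, in which every variable occurs in at most $k$ terms, where $$k \;\le\; c\,\frac{\log\log s}{\log\log\log s}$$ ($\log$ is the logarithm to base $2$). Then $f$ is $\varepsilon$-concentrated on $(s/\varepsilon)^{C\log(1/\varepsilon)}$ coefficients; that is, there is a family $\mathcal{S}$ of subsets of $[n]$ with $|\mathcal{S}| \le (s/\varepsilon)^{C\log(1/\varepsilon)}$ and $$\sum_{S \subseteq [n],\; S \notin \mathcal{S}} \hat f(S)^2 \;\le\; \varepsilon, \qquad\text{where } \hat f(S) = \mathop{\mathbf{E}}_{x \in \{-1,1\}^n}\Big[f(x)\prod_{i \in S} x_i\Big].$$ -/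

import Mathlib

open scoped BigOperators

namespace BooleanFourier

/-- The cube `{-1, 1}ⁿ`; the input value `-1` stands for "true" and `1` for "false". -/
abbrev Cube (n : ℕ) : Type := Fin n → ℤˣ

/-- The monomial `x^S = ∏ i ∈ S, x i`. -/
def chi {n : ℕ} (S : Finset (Fin n)) (x : Cube n) : ℝ :=
  ∏ i ∈ S, ((x i : ℤ) : ℝ)

/-- The Fourier coefficient of `f` at `S`: the expectation of `f x * x^S` over a uniformly random
point `x` of the cube. -/
noncomputable def cubeFourierCoeff {n : ℕ} (f : Cube n → ℝ) (S : Finset (Fin n)) : ℝ :=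
  𝔼 x, f x * chi S x

/-- `f` is `ε`-concentrated on the family `F`: the squared Fourier coefficients
outside `F` sum to at most `ε`. -/
def ConcentratedOn {n : ℕ} (ε : ℝ) (f : Cube n → ℝ) (F : Finset (Finset (Fin n))) : Prop :=
  ∑ S ∈ Fᶜ, cubeFourierCoeff f S ^ 2 ≤ ε

/-- `f` is `ε`-concentrated on `M` coefficients (`M` need not be an integer). -/
def ConcentratedOnCoeffs {n : ℕ} (ε : ℝ) (f : Cube n → ℝ) (M : ℝ) : Prop :=
  ∃ F : Finset (Finset (Fin n)), (F.card : ℝ) ≤ M ∧ ConcentratedOn ε f F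

/-- A term (a conjunction of literals on distinct variables), given by the value that it demands of
each variable: `some (-1)` for the literal `xᵢ`, `some 1` for its negation, and `none` if the
variable does not occur. -/
abbrev Term (n : ℕ) : Type := Fin n → Option ℤˣ

/-- The set of variables that occur in the term. -/
def Term.vars {n : ℕ} (T : Term n) : Finset (Fin n) :=
  Finset.univ.filter fun i => T i ≠ none

/-- The input `x` satisfies every literal of the term. -/
def Term.Sat {n : ℕ} (T : Term n) (x : Cube n) : Prop :=
  ∀ i ∈ Term.vars T, T i = some (x i)

/-- A DNF formula in `n` variables: a disjunction of `size` terms. -/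
structure DNF (n : ℕ) where
  /-- the number of terms -/
  size : ℕ
  /-- the terms -/
  term : Fin size → Term n

/-- The Boolean function computed by the formula, with values `1` (true) and `0` (false). -/
noncomputable def DNF.eval {n : ℕ} (φ : DNF n) (x : Cube n) : ℝ :=
  open Classical in if ∃ j, Term.Sat (φ.term j) x then 1 else 0

/-- The formula is read-`k`: every variable occurs in at most `k` of the terms. -/
def DNF.IsRead {n : ℕ} (φ : DNF n) (k : ℕ) : Prop :=
  ∀ i : Fin n, (Finset.univ.filter fun j => i ∈ Term.vars (φ.term j)).card ≤ k

end BooleanFourier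

/-!
Up to an error of `ε`, a DNF formula with `s` terms is determined by its terms of width at most
`W = O(log (s / ε))`. A polynomial of low degree in the indicators of some events has its
Fourier support on subsets of unions of the variable sets of few such events, and a union of
`O(log (1 / ε))` sets of size `O(W)`, each chosen among `s`, has `(s / ε) ^ O(log (1 / ε))` choices
including the choice of a subset. So it suffices to approximate the formula in mean square by
inclusion-exclusion truncated at level `d = O(log (1 / ε))`. If `Y` events occur, then the
truncation is exact for `Y ≤ d` and at most `2 ^ Y` otherwise, and hence the error is at most
`2 ^ (-d) 𝔼 64 ^ Y`. It remains to bound the exponential moment by `(1 / ε) ^ O(1)`, unless the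
formula is unsatisfied with probability less than `ε`, when it is nearly constant.

Counting all satisfied terms is too expensive, since up to `k` terms may share almost all of their
variables. Finner's inequality `expect_prod_le_of_read` (Hölder's inequality for functions reading
every coordinate at most `k` times) only gives `𝔼 64 ^ Y ≤ (1 / ε) ^ O(64 ^ k)`. This is good enough
for the *narrow* terms, of width less than `v = W ^ (9 / 10)`: there are only `2 ^ O(v)` of them,
they have few variables, and `64 ^ k` is much smaller than `W / v`, so that a higher truncation
level is affordable.

Of the *wide* terms, of width between `v` and `W`, only the *fresh* ones are counted
(`freshInd`): the satisfied terms such that no earlier satisfied term is almost contained in them,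
up to `a = W ^ (3 / 10)` variables. Some term is satisfied if and only if some term is fresh
(`prod_one_sub_freshInd`), and freshness of a term depends on at most `2 W` variables, as only few
wide terms can be almost contained in a given one (`card_freshVars_le`). Two fresh terms that
interact are satisfied together with probability at most `2 ^ (-a)` times the probability of one
of them, and this beats all the other factors. Therefore the fresh terms behave like independent
events. On the one hand, the probability that none occurs is at most about `exp (-μ)`, where `μ` is
their expected number; this is a Suen-type inequality (`expect_prod_one_sub_le_exp`), derived from
the Lovász local lemma, and it gives `μ = O(log (1 / ε))`. On the other hand,
`𝔼 64 ^ Y ≤ exp (O(μ))` up to a negligible error (`expect_prod_one_add_fresh_le`). The latter is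
proved term by term, using that conditioning on the values of the variables in a set `R` raises the
exponential moment by a factor of at most `exp (θ |R|)` with a tiny `θ`
(`expect_mul_prod_fresh_le`).
-/

namespace BooleanFourier

/-! ### Functions on the cube: independence and flips -/

theorem dependsOn_mul {n : ℕ} {g h : Cube n → ℝ} {A B : Set (Fin n)} (hg : DependsOn g A)
    (hh : DependsOn h B) : DependsOn (fun x => g x * h x) (A ∪ B) := fun x y hxy => by
  simp only [hg fun i hi => hxy i (Or.inl hi), hh fun i hi => hxy i (Or.inr hi)]

theorem dependsOn_prod {n : ℕ} {ι : Type*} (s : Finset ι) {g : ι → Cube n → ℝ}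
    {A : Set (Fin n)} (hg : ∀ j ∈ s, DependsOn (g j) A) :
    DependsOn (fun x => ∏ j ∈ s, g j x) A := fun _ _ hxy =>
  Finset.prod_congr rfl fun j hj => hg j hj hxy

/-- Functions of disjoint sets of coordinates are independent under the uniform distribution. -/
theorem expect_mul_of_dependsOn {n : ℕ} {g h : Cube n → ℝ} {A B : Set (Fin n)}
    (hg : DependsOn g A) (hh : DependsOn h B) (hAB : Disjoint A B) :
    𝔼 x, g x * h x = (𝔼 x, g x) * 𝔼 x, h x := by
  classical
  -- Exchanging the coordinates in `B` between two independent points preserves their law.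
  let σ : Cube n × Cube n → Cube n × Cube n :=
    fun p => (B.piecewise p.2 p.1, B.piecewise p.1 p.2)
  have hσ : Function.Involutive σ := by
    rintro ⟨x, y⟩
    refine Prod.ext ?_ ?_ <;> funext i <;> by_cases hi : i ∈ B <;> simp [σ, hi]
  have key : 𝔼 p : Cube n × Cube n, g p.1 * h p.2 = 𝔼 p : Cube n × Cube n, g p.1 * h p.1 := by
    refine Fintype.expect_equiv hσ.toPerm _ _ fun p => ?_
    have h1 : g (B.piecewise p.2 p.1) = g p.1 := hg fun i hi => by
      simp [Set.disjoint_left.1 hAB hi]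
    have h2 : h (B.piecewise p.2 p.1) = h p.2 := hh fun i hi => by simp [hi]
    simp [σ, h1, h2]
  rw [← Finset.univ_product_univ, Finset.expect_product, Finset.expect_product] at key
  simp only [Fintype.expect_const] at key
  rw [← key, Finset.expect_mul_expect]

/-- The point obtained from `x` by flipping the coordinate `i`. -/
def flip {n : ℕ} (i : Fin n) (x : Cube n) : Cube n := Function.update x i (-x i)

theorem flip_involutive {n : ℕ} (i : Fin n) : Function.Involutive (flip i) := fun x => by
  simp [flip]

theorem expect_flip {n : ℕ} (i : Fin n) (f : Cube n → ℝ) : 𝔼 x, f (flip i x) = 𝔼 x, f x :=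
  Fintype.expect_equiv (flip_involutive i).toPerm _ _ fun _ => rfl

theorem expect_coord {n : ℕ} (i : Fin n) (b : ℤˣ) :
    𝔼 x : Cube n, (if x i = b then (1 : ℝ) else 0) = 1 / 2 := by
  have h := expect_flip i fun x : Cube n => if x i = b then (1 : ℝ) else 0
  have h1 : (𝔼 x : Cube n, (if x i = b then (1 : ℝ) else 0)) +
      𝔼 x : Cube n, (if flip i x i = b then (1 : ℝ) else 0) = 1 := by
    rw [← Finset.expect_add_distrib, ← Fintype.expect_one (ι := Cube n) (M := ℝ)]
    refine Finset.expect_congr rfl fun x _ => ?_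
    rcases Int.units_eq_one_or (x i) with hx | hx <;> rcases Int.units_eq_one_or b with hb | hb <;>
      simp [flip, hx, hb]
  linarith

theorem expect_agree {n : ℕ} (V : Finset (Fin n)) (y : Cube n) :
    𝔼 x : Cube n, (if ∀ i ∈ V, x i = y i then (1 : ℝ) else 0) = (1 / 2) ^ V.card := by
  induction V using Finset.induction_on with
  | empty => simp
  | insert i V hi ih =>
    rw [Finset.card_insert_of_notMem hi, pow_succ, ← ih, ← expect_coord i (y i),
      ← expect_mul_of_dependsOn (A := V) (B := {i})]
    · refine Finset.expect_congr rfl fun x _ => ?_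
      by_cases h1 : x i = y i <;> simp [h1]
    · exact fun x z hxz => by
        congr 1
        exact propext (forall₂_congr fun j hj => by rw [hxz j hj])
    · exact fun x z hxz => by rw [hxz i rfl]
    · simpa using hi

/-- An event any two points of which agree on `V` has probability at most `2 ^ (-|V|)`. -/
theorem expect_indicator_le {n : ℕ} (V : Finset (Fin n)) (E : Cube n → Prop) [DecidablePred E]
    (hE : ∀ x y, E x → E y → ∀ i ∈ V, x i = y i) :
    𝔼 x : Cube n, (if E x then (1 : ℝ) else 0) ≤ (1 / 2) ^ V.card := by
  by_cases h : ∃ y, E y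
  · obtain ⟨y, hy⟩ := h
    rw [← expect_agree V y]
    refine Finset.expect_le_expect fun x _ => ?_
    by_cases hx : E x
    · rw [if_pos hx, if_pos (hE x y hx hy)]
    · rw [if_neg hx]; split_ifs <;> norm_num
  · push Not at h
    simp [h]

/-! ### Fourier coefficients -/

theorem cubeFourierCoeff_sub {n : ℕ} (f g : Cube n → ℝ) (S : Finset (Fin n)) :
    cubeFourierCoeff (fun x => f x - g x) S = cubeFourierCoeff f S - cubeFourierCoeff g S := by
  simp [cubeFourierCoeff, sub_mul, Finset.expect_sub_distrib]

theorem cubeFourierCoeff_sum {n : ℕ} {ι : Type*} (s : Finset ι) (f : ι → Cube n → ℝ)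
    (S : Finset (Fin n)) :
    cubeFourierCoeff (fun x => ∑ j ∈ s, f j x) S = ∑ j ∈ s, cubeFourierCoeff (f j) S := by
  simp [cubeFourierCoeff, Finset.sum_mul, Finset.expect_sum_comm]

theorem chi_flip {n : ℕ} {S : Finset (Fin n)} {i : Fin n} (hi : i ∈ S) (x : Cube n) :
    chi S (flip i x) = -chi S x := by
  unfold chi
  rw [← Finset.mul_prod_erase _ _ hi, ← Finset.mul_prod_erase S _ hi, ← neg_mul]
  congr 1
  · simp [flip]
  · exact Finset.prod_congr rfl fun j hj => by simp [flip, Finset.ne_of_mem_erase hj]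

theorem chi_flip_of_notMem {n : ℕ} {S : Finset (Fin n)} {i : Fin n} (hi : i ∉ S) (x : Cube n) :
    chi S (flip i x) = chi S x :=
  Finset.prod_congr rfl fun j hj => by
    simp [flip, Function.update_of_ne (ne_of_mem_of_not_mem hj hi)]

theorem chi_mul_self {n : ℕ} (S : Finset (Fin n)) (x : Cube n) : chi S x * chi S x = 1 := by
  unfold chi
  rw [← Finset.prod_mul_distrib]
  refine Finset.prod_eq_one fun i _ => ?_
  rcases Int.units_eq_one_or (x i) with h | h <;> simp [h]

/-- A function of the variables in `V` has no Fourier coefficients outside the subsets of `V`. -/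
theorem cubeFourierCoeff_eq_zero {n : ℕ} {f : Cube n → ℝ} {V S : Finset (Fin n)}
    (hf : DependsOn f (V : Set (Fin n))) (hS : ¬ S ⊆ V) : cubeFourierCoeff f S = 0 := by
  obtain ⟨i, hiS, hiV⟩ := Finset.not_subset.1 hS
  have h := expect_flip i fun x => f x * chi S x
  have h1 : ∀ x, f (flip i x) = f x := fun x => hf fun j hj => by
    simp [flip, Function.update_of_ne (ne_of_mem_of_not_mem (Finset.mem_coe.1 hj) hiV)]
  simp only [chi_flip hiS, h1, mul_neg, Finset.expect_neg_distrib] at h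
  unfold cubeFourierCoeff
  linarith

theorem expect_chi_mul_chi {n : ℕ} (S T : Finset (Fin n)) :
    𝔼 x : Cube n, chi S x * chi T x = if S = T then 1 else 0 := by
  split_ifs with h
  · simp [h, chi_mul_self]
  · obtain ⟨i, hi⟩ : ∃ i, ¬ (i ∈ S ↔ i ∈ T) := by
      by_contra! h'
      exact h (Finset.ext h')
    have h2 := expect_flip i fun x : Cube n => chi S x * chi T x
    by_cases hS : i ∈ S
    · have hT : i ∉ T := by tauto
      simp only [chi_flip hS, chi_flip_of_notMem hT, neg_mul, Finset.expect_neg_distrib] at h2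
      linarith
    · have hT : i ∈ T := by tauto
      simp only [chi_flip hT, chi_flip_of_notMem hS, mul_neg, Finset.expect_neg_distrib] at h2
      linarith

/-- Bessel's inequality. -/
theorem sum_sq_cubeFourierCoeff_le {n : ℕ} (h : Cube n → ℝ) :
    ∑ S, cubeFourierCoeff h S ^ 2 ≤ 𝔼 x, h x ^ 2 := by
  have h0 : 0 ≤ 𝔼 x, (h x - ∑ S, cubeFourierCoeff h S * chi S x) ^ 2 :=
    Finset.expect_nonneg fun x _ => sq_nonneg _
  have h1 : 𝔼 x, (h x * ∑ S, cubeFourierCoeff h S * chi S x) = ∑ S, cubeFourierCoeff h S ^ 2 := by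
    simp only [Finset.mul_sum, Finset.expect_sum_comm]
    refine Finset.sum_congr rfl fun S _ => ?_
    rw [sq]
    nth_rewrite 3 [cubeFourierCoeff]
    rw [Finset.mul_expect]
    exact Finset.expect_congr rfl fun x _ => by ring
  have h2 : 𝔼 x : Cube n, (∑ S, cubeFourierCoeff h S * chi S x) ^ 2 =
      ∑ S, cubeFourierCoeff h S ^ 2 := by
    simp only [sq, Finset.sum_mul_sum, Finset.expect_sum_comm]
    refine Finset.sum_congr rfl fun S _ => ?_
    have : ∀ T, 𝔼 x : Cube n, cubeFourierCoeff h S * chi S x * (cubeFourierCoeff h T * chi T x) =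
        cubeFourierCoeff h S * cubeFourierCoeff h T * if S = T then 1 else 0 := fun T => by
      rw [← expect_chi_mul_chi, Finset.mul_expect]
      exact Finset.expect_congr rfl fun x _ => by ring
    simp [this]
  have h3 : 𝔼 x, (h x - ∑ S, cubeFourierCoeff h S * chi S x) ^ 2 =
      (𝔼 x, h x ^ 2) - 2 * (𝔼 x, (h x * ∑ S, cubeFourierCoeff h S * chi S x)) +
        𝔼 x : Cube n, (∑ S, cubeFourierCoeff h S * chi S x) ^ 2 := by
    rw [Finset.mul_expect, ← Finset.expect_sub_distrib, ← Finset.expect_add_distrib]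
    exact Finset.expect_congr rfl fun x _ => by ring
  rw [h3, h1, h2] at h0
  linarith

/-- A mean-square approximation by a function with Fourier support in `F` gives concentration
on `F`. -/
theorem concentratedOn_of_approx {n : ℕ} {ε : ℝ} {f g : Cube n → ℝ}
    {F : Finset (Finset (Fin n))} (hg : ∀ S ∉ F, cubeFourierCoeff g S = 0)
    (hfg : 𝔼 x, (f x - g x) ^ 2 ≤ ε) : ConcentratedOn ε f F := by
  classical
  refine le_trans ?_ ((sum_sq_cubeFourierCoeff_le fun x => f x - g x).trans hfg)
  calc ∑ S ∈ Fᶜ, cubeFourierCoeff f S ^ 2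
      = ∑ S ∈ Fᶜ, cubeFourierCoeff (fun x => f x - g x) S ^ 2 :=
        Finset.sum_congr rfl fun S hS => by
          rw [cubeFourierCoeff_sub, hg S (Finset.mem_compl.1 hS), sub_zero]
    _ ≤ _ := Finset.sum_le_sum_of_subset_of_nonneg (Finset.subset_univ _) fun _ _ _ => sq_nonneg _

/-! ### Finner's inequality -/

/-- Hölder's inequality for at most `κ` functions, all taken in `L^κ`. -/
theorem expect_prod_le_of_card_le {α ι : Type*} [Fintype α] [Nonempty α] {κ : ℕ} (hκ : 0 < κ)
    (s : Finset ι) (h : ι → α → ℝ) (h0 : ∀ j a, 0 ≤ h j a) (hs : s.card ≤ κ) :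
    𝔼 a, ∏ j ∈ s, h j a ≤ ∏ j ∈ s, (𝔼 a, h j a ^ κ) ^ (1 / κ : ℝ) := by
  have hκ' : (0 : ℝ) < κ := by exact_mod_cast hκ
  have hH0 : ∀ j, 0 ≤ 𝔼 a, h j a ^ κ := fun j =>
    Finset.expect_nonneg fun a _ => pow_nonneg (h0 j a) _
  by_cases hz : ∃ j ∈ s, 𝔼 a, h j a ^ κ = 0
  · obtain ⟨j, hj, hjz⟩ := hz
    have hz' : ∀ a, h j a = 0 := fun a => by
      have := (Finset.expect_eq_zero_iff_of_nonneg fun a _ => pow_nonneg (h0 j a) κ).1 hjz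
        a (Finset.mem_univ a)
      exact pow_eq_zero_iff hκ.ne' |>.1 this
    rw [Finset.expect_eq_zero fun a _ => Finset.prod_eq_zero hj (hz' a)]
    exact Finset.prod_nonneg fun j _ => Real.rpow_nonneg (hH0 j) _
  push Not at hz
  have hpos : ∀ j ∈ s, 0 < 𝔼 a, h j a ^ κ := fun j hj => lt_of_le_of_ne (hH0 j) (hz j hj).symm
  set H : ι → ℝ := fun j => 𝔼 a, h j a ^ κ with hH
  -- weighted AM-GM after normalisation; the missing weight goes to the constant `1`
  have amgm : ∀ a, ∏ j ∈ s, h j a ≤ (∏ j ∈ s, H j ^ (1 / κ : ℝ)) *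
      ((1 - s.card / κ : ℝ) + ∑ j ∈ s, (1 / κ : ℝ) * (h j a ^ κ / H j)) := fun a => by
    have h1 := Real.geom_mean_le_arith_mean_weighted (Finset.insertNone s)
      (fun o => o.elim (1 - s.card / κ : ℝ) fun _ => (1 / κ : ℝ))
      (fun o => o.elim 1 fun j => h j a ^ κ / H j) ?_ ?_ ?_
    · simp only [Finset.prod_insertNone, Finset.sum_insertNone, Option.elim, Real.one_rpow,
        one_mul, mul_one] at h1
      refine le_trans (le_of_eq ?_) (mul_le_mul_of_nonneg_left h1
        (Finset.prod_nonneg fun j _ => Real.rpow_nonneg (hH0 j) _))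
      rw [← Finset.prod_mul_distrib]
      refine Finset.prod_congr rfl fun j hj => ?_
      rw [← Real.mul_rpow (hH0 j) (div_nonneg (pow_nonneg (h0 j a) _) (hH0 j)),
        mul_div_cancel₀ _ (hpos j hj).ne', one_div, Real.pow_rpow_inv_natCast (h0 j a) hκ.ne']
    · rintro (_ | j) _
      · have : (s.card : ℝ) ≤ κ := by exact_mod_cast hs
        simpa using div_le_one_of_le₀ this hκ'.le
      · simp
    · simp only [Finset.sum_insertNone, Option.elim, Finset.sum_const, nsmul_eq_mul]
      ring
    · rintro (_ | j) _
      · simp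
      · exact div_nonneg (pow_nonneg (h0 j a) _) (hH0 j)
  refine (Finset.expect_le_expect fun a _ => amgm a).trans (le_of_eq ?_)
  rw [← Finset.mul_expect, Finset.expect_add_distrib, Fintype.expect_const,
    Finset.expect_sum_comm]
  have : ∀ j ∈ s, 𝔼 a, (1 / κ : ℝ) * (h j a ^ κ / H j) = 1 / κ := fun j hj => by
    rw [← Finset.mul_expect, ← Finset.expect_div, div_self (hpos j hj).ne', mul_one]
  rw [Finset.sum_congr rfl this, Finset.sum_const, nsmul_eq_mul]
  ring

theorem expect_cons {n : ℕ} (f : Cube (n + 1) → ℝ) :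
    𝔼 x, f x = 𝔼 b : ℤˣ, 𝔼 y : Cube n, f (Fin.cons b y) := by
  rw [← Finset.expect_product' Finset.univ Finset.univ fun b (y : Cube n) => f (Fin.cons b y)]
  exact (Fintype.expect_equiv (Fin.consEquiv fun _ : Fin (n + 1) => ℤˣ) _ _ fun _ => rfl).symm

/-- Finner's inequality: if every coordinate is read by at most `κ` of the functions, then
Hölder's inequality with exponent `κ` holds, however many functions there are. -/
theorem expect_prod_le_of_read {κ : ℕ} (hκ : 0 < κ) {ι : Type*} (s : Finset ι) :
    ∀ {n : ℕ} (g : ι → Cube n → ℝ) (V : ι → Finset (Fin n)), (∀ j x, 0 ≤ g j x) →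
      (∀ j, DependsOn (g j) (V j : Set (Fin n))) →
      (∀ i, (s.filter fun j => i ∈ V j).card ≤ κ) →
      𝔼 x, ∏ j ∈ s, g j x ≤ ∏ j ∈ s, (𝔼 x, g j x ^ κ) ^ (1 / κ : ℝ)
  | 0, g, V, g0, _, _ => by
    have e : ∀ f : Cube 0 → ℝ, 𝔼 x, f x = f default := fun f => by
      rw [Finset.expect_congr rfl fun x _ => congrArg f (Subsingleton.elim x default)]
      exact Fintype.expect_const _
    rw [e]
    refine Finset.prod_le_prod (fun j _ => g0 j _) fun j _ => ?_
    rw [e, one_div, Real.pow_rpow_inv_natCast (g0 j _) hκ.ne']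
  | n + 1, g, V, g0, gV, hr => by
    classical
    set G : ι → ℤˣ → ℝ := fun j b => (𝔼 y : Cube n, g j (Fin.cons b y) ^ κ) ^ (1 / κ : ℝ) with hG
    have hE0 : ∀ j b, 0 ≤ 𝔼 y : Cube n, g j (Fin.cons b y) ^ κ := fun j b =>
      Finset.expect_nonneg fun y _ => pow_nonneg (g0 j _) _
    have hG0 : ∀ j b, 0 ≤ G j b := fun j b => Real.rpow_nonneg (hE0 j b) _
    have hGpow : ∀ j b, G j b ^ κ = 𝔼 y : Cube n, g j (Fin.cons b y) ^ κ := fun j b => by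
      simp only [hG, one_div]
      exact Real.rpow_inv_natCast_pow (hE0 j b) hκ.ne'
    have step1 : ∀ b, 𝔼 y : Cube n, ∏ j ∈ s, g j (Fin.cons b y) ≤ ∏ j ∈ s, G j b := fun b =>
      expect_prod_le_of_read hκ s (fun j y => g j (Fin.cons b y))
        (fun j => Finset.univ.filter fun i => i.succ ∈ V j) (fun j y => g0 j _)
        (fun j y z hyz => gV j fun i hi => by
          refine Fin.cases (fun _ => rfl) (fun i hi => ?_) i hi
          simpa using hyz i (by simpa using hi))
        (fun i => by simpa using hr i.succ)
    have hconst : ∀ j, 0 ∉ V j → ∀ b c, G j b = G j c := fun j hj b c => by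
      simp only [hG]
      congr 1
      refine Finset.expect_congr rfl fun y _ => ?_
      congr 1
      refine gV j fun i hi => ?_
      refine Fin.cases (fun h => absurd h hj) (fun i _ => rfl) i hi
    rw [expect_cons]
    refine (Finset.expect_le_expect fun b _ => step1 b).trans ?_
    calc 𝔼 b, ∏ j ∈ s, G j b
        = (∏ j ∈ s with ¬ (0 ∈ V j), G j 1) * 𝔼 b, ∏ j ∈ s with 0 ∈ V j, G j b := by
          rw [Finset.mul_expect]
          refine Finset.expect_congr rfl fun b _ => ?_
          rw [← Finset.prod_filter_mul_prod_filter_not s (fun j => 0 ∈ V j), mul_comm]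
          congr 1
          exact Finset.prod_congr rfl fun j hj => hconst j (Finset.mem_filter.1 hj).2 _ _
      _ ≤ (∏ j ∈ s with ¬ (0 ∈ V j), G j 1) *
            ∏ j ∈ s with 0 ∈ V j, (𝔼 b, G j b ^ κ) ^ (1 / κ : ℝ) :=
          mul_le_mul_of_nonneg_left (expect_prod_le_of_card_le hκ _ G hG0 (hr 0))
            (Finset.prod_nonneg fun j _ => hG0 j 1)
      _ = ∏ j ∈ s, (𝔼 x, g j x ^ κ) ^ (1 / κ : ℝ) := by
          rw [← Finset.prod_filter_mul_prod_filter_not s (fun j => 0 ∈ V j), mul_comm]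
          congr 1
          · refine Finset.prod_congr rfl fun j _ => ?_
            rw [expect_cons fun x => g j x ^ κ]
            simp only [hGpow]
          · refine Finset.prod_congr rfl fun j hj => ?_
            rw [expect_cons fun x => g j x ^ κ]
            simp only [← hGpow]
            rw [Finset.expect_congr rfl fun b _ => by
              rw [hconst j (Finset.mem_filter.1 hj).2 b 1], Fintype.expect_const, one_div,
              Real.pow_rpow_inv_natCast (hG0 j 1) hκ.ne']

/-! ### Terms -/

/-- The indicator function of the event that the term is satisfied. -/
noncomputable def Term.ind {n : ℕ} (T : Term n) (x : Cube n) : ℝ :=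
  open Classical in if T.Sat x then 1 else 0

theorem Term.ind_nonneg {n : ℕ} (T : Term n) (x : Cube n) : 0 ≤ T.ind x := by
  unfold Term.ind; split_ifs <;> norm_num

theorem Term.ind_le_one {n : ℕ} (T : Term n) (x : Cube n) : T.ind x ≤ 1 := by
  unfold Term.ind; split_ifs <;> norm_num

theorem Term.dependsOn_ind {n : ℕ} (T : Term n) : DependsOn T.ind (T.vars : Set (Fin n)) :=
  fun x y hxy => by
    unfold Term.ind
    congr 1
    exact propext (forall₂_congr fun i hi => by rw [hxy i hi])

theorem Term.expect_ind {n : ℕ} (T : Term n) : 𝔼 x, T.ind x = (1 / 2) ^ T.vars.card := by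
  rw [← expect_agree T.vars fun i => (T i).getD 1]
  refine Finset.expect_congr rfl fun x _ => ?_
  unfold Term.ind Term.Sat
  congr 1
  refine propext (forall₂_congr fun i hi => ?_)
  obtain ⟨b, hb⟩ := Option.ne_none_iff_exists'.1 (Finset.mem_filter.1 hi).2
  simp [hb, eq_comm]

/-- The function `1 + c T` of a read-`κ` family of terms `T`, multiplied over the family, has
expectation at most `exp (((1 + c) ^ κ - 1) / κ * ∑ 2 ^ (-|T|))`. -/
theorem expect_prod_one_add_le {n κ : ℕ} (hκ : 0 < κ) {ι : Type*} [Fintype ι] (t : ι → Term n)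
    (hr : ∀ i, (Finset.univ.filter fun j => i ∈ (t j).vars).card ≤ κ) {c : ℝ} (hc : -1 ≤ c) :
    𝔼 x, ∏ j, (1 + c * (t j).ind x) ≤
      Real.exp (((1 + c) ^ κ - 1) / κ * ∑ j, (1 / 2 : ℝ) ^ (t j).vars.card) := by
  have h0 : ∀ j x, 0 ≤ 1 + c * (t j).ind x := fun j x => by
    unfold Term.ind; split_ifs <;> linarith
  refine (expect_prod_le_of_read hκ Finset.univ (fun j x => 1 + c * (t j).ind x)
    (fun j => (t j).vars) h0 (fun j x y hxy => by simp only [(t j).dependsOn_ind hxy]) hr).trans ?_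
  rw [Finset.mul_sum, Real.exp_sum]
  refine Finset.prod_le_prod (fun j _ => Real.rpow_nonneg
    (Finset.expect_nonneg fun x _ => pow_nonneg (h0 j x) _) _) fun j _ => ?_
  have h1 : 𝔼 x, (1 + c * (t j).ind x) ^ κ =
      1 + ((1 + c) ^ κ - 1) * (1 / 2 : ℝ) ^ (t j).vars.card := by
    rw [← Term.expect_ind, Finset.mul_expect, ← Fintype.expect_one (ι := Cube n) (M := ℝ),
      ← Finset.expect_add_distrib]
    refine Finset.expect_congr rfl fun x _ => ?_
    unfold Term.ind; split_ifs <;> simp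
  have h2 : 0 ≤ 1 + ((1 + c) ^ κ - 1) * (1 / 2 : ℝ) ^ (t j).vars.card := by
    rw [← h1]
    exact Finset.expect_nonneg fun x _ => pow_nonneg (h0 j x) _
  rw [h1]
  calc (1 + ((1 + c) ^ κ - 1) * (1 / 2 : ℝ) ^ (t j).vars.card) ^ (1 / κ : ℝ)
      ≤ (Real.exp (((1 + c) ^ κ - 1) * (1 / 2 : ℝ) ^ (t j).vars.card)) ^ (1 / κ : ℝ) :=
        Real.rpow_le_rpow h2 (by rw [add_comm]; exact Real.add_one_le_exp _) (by positivity)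
    _ = _ := by
        rw [← Real.exp_mul]
        congr 1
        ring

/-- If the formula given by a read-`κ` family of terms is unsatisfied with probability at least
`exp (-r)`, then the terms' probabilities sum to at most `κ r`. -/
theorem sum_half_pow_le {n κ : ℕ} (hκ : 0 < κ) {ι : Type*} [Fintype ι] (t : ι → Term n)
    (hr : ∀ i, (Finset.univ.filter fun j => i ∈ (t j).vars).card ≤ κ) {r : ℝ}
    (h : Real.exp (-r) ≤ 𝔼 x, ∏ j, (1 - (t j).ind x)) :
    ∑ j, (1 / 2 : ℝ) ^ (t j).vars.card ≤ κ * r := by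
  have h1 := expect_prod_one_add_le hκ t hr (c := -1) le_rfl
  simp only [neg_mul, one_mul, ← sub_eq_add_neg] at h1
  have h2 := Real.exp_le_exp.1 (h.trans h1)
  have hκ' : (0 : ℝ) < κ := by exact_mod_cast hκ
  rw [sub_self, zero_pow hκ.ne', zero_sub, div_mul_eq_mul_div, le_div_iff₀ hκ'] at h2
  linarith

/-! ### Avoiding weakly dependent events -/

theorem one_sub_sum_le_prod_one_sub {ι : Type*} (s : Finset ι) (f : ι → ℝ) (h0 : ∀ i, 0 ≤ f i)
    (h1 : ∀ i, f i ≤ 1) : 1 - ∑ i ∈ s, f i ≤ ∏ i ∈ s, (1 - f i) := by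
  classical
  induction s using Finset.induction_on with
  | empty => simp
  | insert i s hi ih =>
    rw [Finset.sum_insert hi, Finset.prod_insert hi]
    have hp : ∏ i ∈ s, (1 - f i) ≤ 1 :=
      Finset.prod_le_one (fun i _ => sub_nonneg.2 (h1 i)) fun i _ => by linarith [h0 i]
    nlinarith [h0 i, h1 i]

section Avoid

variable {n : ℕ} {ι : Type*} {X : ι → Cube n → ℝ} {U : ι → Finset (Fin n)}

theorem prod_one_sub_nonneg (h1 : ∀ j x, X j x ≤ 1) (M : Finset ι) (x : Cube n) :
    0 ≤ ∏ l ∈ M, (1 - X l x) :=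
  Finset.prod_nonneg fun l _ => sub_nonneg.2 (h1 l x)

theorem prod_one_sub_anti (h0 : ∀ j x, 0 ≤ X j x) (h1 : ∀ j x, X j x ≤ 1) {M M' : Finset ι}
    (hM : M' ⊆ M) (x : Cube n) : ∏ l ∈ M, (1 - X l x) ≤ ∏ l ∈ M', (1 - X l x) := by
  classical
  rw [← Finset.prod_sdiff hM]
  exact mul_le_of_le_one_left (prod_one_sub_nonneg h1 M' x)
    (Finset.prod_le_one (fun i _ => sub_nonneg.2 (h1 i x)) fun i _ => by linarith [h0 i x])

theorem expect_mul_prod_filter_disjoint (hU : ∀ j, DependsOn (X j) (U j : Set (Fin n)))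
    {F : ℝ → ℝ} {g : Cube n → ℝ} {R : Finset (Fin n)} (hg : DependsOn g (R : Set (Fin n)))
    (M : Finset ι) :
    𝔼 x, g x * ∏ l ∈ M with Disjoint (U l) R, F (X l x) =
      (𝔼 x, g x) * 𝔼 x, ∏ l ∈ M with Disjoint (U l) R, F (X l x) :=
  expect_mul_of_dependsOn (B := (R : Set (Fin n))ᶜ) hg
    (dependsOn_prod _ fun l hl x y hxy => by
      rw [hU l fun i hi => hxy i fun hiR =>
        Finset.disjoint_left.1 (Finset.mem_filter.1 hl).2 hi hiR])
    disjoint_compl_right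

/-- Removing the events of `K` from the avoided ones costs at most the factor `1 - 2 p |K|`,
provided that each has conditional probability at most `2 p` given that the others are avoided. -/
theorem mul_expect_prod_sdiff_le [DecidableEq ι] (h0 : ∀ j x, 0 ≤ X j x) (h1 : ∀ j x, X j x ≤ 1)
    {p : ℝ} {M K : Finset ι} (hK : K ⊆ M)
    (h : ∀ j ∈ K, 𝔼 x, X j x * ∏ l ∈ M \ K, (1 - X l x) ≤
      2 * p * 𝔼 x, ∏ l ∈ M \ K, (1 - X l x)) :
    (1 - 2 * p * K.card) * 𝔼 x, ∏ l ∈ M \ K, (1 - X l x) ≤ 𝔼 x, ∏ l ∈ M, (1 - X l x) := by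
  have h2 : 𝔼 x, (∏ l ∈ M \ K, (1 - X l x) - ∑ j ∈ K, X j x * ∏ l ∈ M \ K, (1 - X l x)) ≤
      𝔼 x, ∏ l ∈ M, (1 - X l x) := by
    refine Finset.expect_le_expect fun x _ => ?_
    rw [← Finset.prod_sdiff hK, ← Finset.sum_mul]
    have := mul_le_mul_of_nonneg_left
      (one_sub_sum_le_prod_one_sub K (fun j => X j x) (fun j => h0 j x) fun j => h1 j x)
      (prod_one_sub_nonneg h1 (M \ K) x)
    linarith
  rw [Finset.expect_sub_distrib, Finset.expect_sum_comm] at h2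
  have h3 := Finset.sum_le_sum h
  rw [Finset.sum_const, nsmul_eq_mul] at h3
  linarith

/-- The symmetric Lovász local lemma, in its conditional form. -/
theorem expect_mul_prod_one_sub_le [DecidableEq ι] (h0 : ∀ j x, 0 ≤ X j x)
    (h1 : ∀ j x, X j x ≤ 1) (hU : ∀ j, DependsOn (X j) (U j : Set (Fin n))) {p D : ℝ}
    (hp : ∀ j, 𝔼 x, X j x ≤ p)
    (hD : ∀ (M : Finset ι) j, ((M.filter fun l => ¬ Disjoint (U l) (U j)).card : ℝ) ≤ D)
    (hpD : 8 * p * D ≤ 1) (M : Finset ι) :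
    ∀ j, 𝔼 x, X j x * ∏ l ∈ M, (1 - X l x) ≤ 2 * p * 𝔼 x, ∏ l ∈ M, (1 - X l x) := by
  induction M using Finset.strongInduction with
  | H M ih =>
    intro j
    have hp0 : 0 ≤ p := (Finset.expect_nonneg fun x _ => h0 j x).trans (hp j)
    set N := M.filter fun l => ¬ Disjoint (U l) (U j) with hN
    have hMN : M \ N = M.filter fun l => Disjoint (U l) (U j) := by
      ext l; simp only [hN, Finset.mem_sdiff, Finset.mem_filter]; tauto
    have hQ0 : 0 ≤ 𝔼 x, ∏ l ∈ M \ N, (1 - X l x) :=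
      Finset.expect_nonneg fun x _ => prod_one_sub_nonneg h1 _ x
    have hle : 𝔼 x, X j x * ∏ l ∈ M, (1 - X l x) ≤ p * 𝔼 x, ∏ l ∈ M \ N, (1 - X l x) := by
      calc 𝔼 x, X j x * ∏ l ∈ M, (1 - X l x)
          ≤ 𝔼 x, X j x * ∏ l ∈ M \ N, (1 - X l x) :=
            Finset.expect_le_expect fun x _ => mul_le_mul_of_nonneg_left
              (prod_one_sub_anti h0 h1 Finset.sdiff_subset x) (h0 j x)
        _ = (𝔼 x, X j x) * 𝔼 x, ∏ l ∈ M \ N, (1 - X l x) := by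
            rw [hMN]
            exact expect_mul_prod_filter_disjoint (F := fun z => 1 - z) hU (hU j) M
        _ ≤ _ := mul_le_mul_of_nonneg_right (hp j) hQ0
    have hge : (1 - 2 * p * N.card) * 𝔼 x, ∏ l ∈ M \ N, (1 - X l x) ≤
        𝔼 x, ∏ l ∈ M, (1 - X l x) := by
      refine mul_expect_prod_sdiff_le h0 h1 (Finset.filter_subset _ _) fun i hi => ?_
      exact ih (M \ N) (Finset.sdiff_ssubset (Finset.filter_subset _ _) ⟨i, hi⟩) i
    have hcard : p * N.card ≤ p * D := mul_le_mul_of_nonneg_left (hD M j) hp0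
    have : (1 / 2) * 𝔼 x, ∏ l ∈ M \ N, (1 - X l x) ≤ 𝔼 x, ∏ l ∈ M, (1 - X l x) :=
      (mul_le_mul_of_nonneg_right (by linarith) hQ0).trans hge
    nlinarith

/-- A Suen-type inequality: for events of small probability and bounded dependency degree, the
probability that none occurs is at most `exp (-∑ μᵢ)`, up to a correction for dependent pairs. -/
theorem expect_prod_one_sub_le_exp [LinearOrder ι] (h0 : ∀ j x, 0 ≤ X j x)
    (h1 : ∀ j x, X j x ≤ 1) (hU : ∀ j, DependsOn (X j) (U j : Set (Fin n))) {p D : ℝ}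
    (hp : ∀ j, 𝔼 x, X j x ≤ p)
    (hD : ∀ (M : Finset ι) j, ((M.filter fun l => ¬ Disjoint (U l) (U j)).card : ℝ) ≤ D)
    (hpD : 8 * p * D ≤ 1) {η : ι → ℝ}
    (hη : ∀ (M : Finset ι) m, (∀ i ∈ M, i < m) →
      ∑ i ∈ M with ¬ Disjoint (U i) (U m), 𝔼 x, X m x * X i x ≤ η m) (M : Finset ι) :
    𝔼 x, ∏ l ∈ M, (1 - X l x) ≤ Real.exp (-∑ m ∈ M, ((𝔼 x, X m x) - 2 * η m)) := by
  induction M using Finset.induction_on_max with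
  | empty => simp
  | insert m M hm ih =>
    have hmM : m ∉ M := fun h => lt_irrefl _ (hm m h)
    set N := M.filter fun l => ¬ Disjoint (U l) (U m) with hN
    have hMN : M \ N = M.filter fun l => Disjoint (U l) (U m) := by
      ext l; simp only [hN, Finset.mem_sdiff, Finset.mem_filter]; tauto
    set P := 𝔼 x, ∏ l ∈ M, (1 - X l x) with hP
    have hP0 : 0 ≤ P := Finset.expect_nonneg fun x _ => prod_one_sub_nonneg h1 _ x
    have hX0 : 0 ≤ 𝔼 x, X m x := Finset.expect_nonneg fun x _ => h0 m x
    have hp0 : 0 ≤ p := hX0.trans (hp m)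
    have hpair : ∀ i ∈ N, 𝔼 x, X m x * X i x * ∏ l ∈ M \ N, (1 - X l x) ≤
        (𝔼 x, X m x * X i x) * (2 * P) := fun i hi => by
      set K := M.filter fun l => ¬ Disjoint (U l) (U m ∪ U i) with hK
      have hMK : M \ K = M.filter fun l => Disjoint (U l) (U m ∪ U i) := by
        ext l; simp only [hK, Finset.mem_sdiff, Finset.mem_filter]; tauto
      have hsub : M \ K ⊆ M \ N := fun l hl => by
        rw [hMK, Finset.mem_filter] at hl
        rw [hMN, Finset.mem_filter]
        exact ⟨hl.1, hl.2.mono_right Finset.subset_union_left⟩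
      have hxx : ∀ x, 0 ≤ X m x * X i x := fun x => mul_nonneg (h0 m x) (h0 i x)
      have hindep : 𝔼 x, X m x * X i x * ∏ l ∈ M \ K, (1 - X l x) =
          (𝔼 x, X m x * X i x) * 𝔼 x, ∏ l ∈ M \ K, (1 - X l x) := by
        rw [hMK]
        refine expect_mul_prod_filter_disjoint (F := fun z => 1 - z) hU ?_ M
        rw [Finset.coe_union]
        exact dependsOn_mul (hU m) (hU i)
      have hKcard : (K.card : ℝ) ≤ 2 * D := by
        have : K ⊆ (M.filter fun l => ¬ Disjoint (U l) (U m)) ∪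
            M.filter fun l => ¬ Disjoint (U l) (U i) := fun l hl => by
          simp only [hK, Finset.disjoint_union_right, Finset.mem_filter, Finset.mem_union] at hl ⊢
          tauto
        have h3 := (Finset.card_le_card this).trans (Finset.card_union_le _ _)
        have h4 : (K.card : ℝ) ≤ ((M.filter fun l => ¬ Disjoint (U l) (U m)).card : ℝ) +
            ((M.filter fun l => ¬ Disjoint (U l) (U i)).card : ℝ) := by exact_mod_cast h3
        linarith [hD M m, hD M i]
      have hrem := mul_expect_prod_sdiff_le h0 h1 (p := p) (M := M) (K := K)
        (Finset.filter_subset _ _)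
        fun j _ => expect_mul_prod_one_sub_le h0 h1 hU hp hD hpD (M \ K) j
      have hpK : p * K.card ≤ p * (2 * D) := mul_le_mul_of_nonneg_left hKcard hp0
      have hQ0 : 0 ≤ 𝔼 x, ∏ l ∈ M \ K, (1 - X l x) :=
        Finset.expect_nonneg fun x _ => prod_one_sub_nonneg h1 _ x
      have hQ : 𝔼 x, ∏ l ∈ M \ K, (1 - X l x) ≤ 2 * P := by
        have : (1 / 2) * 𝔼 x, ∏ l ∈ M \ K, (1 - X l x) ≤ P :=
          (mul_le_mul_of_nonneg_right (by linarith) hQ0).trans hrem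
        linarith
      calc 𝔼 x, X m x * X i x * ∏ l ∈ M \ N, (1 - X l x)
          ≤ 𝔼 x, X m x * X i x * ∏ l ∈ M \ K, (1 - X l x) :=
            Finset.expect_le_expect fun x _ => mul_le_mul_of_nonneg_left
              (prod_one_sub_anti h0 h1 hsub x) (hxx x)
        _ = (𝔼 x, X m x * X i x) * 𝔼 x, ∏ l ∈ M \ K, (1 - X l x) := hindep
        _ ≤ _ := mul_le_mul_of_nonneg_left hQ (Finset.expect_nonneg fun x _ => hxx x)
    have hlow : (𝔼 x, X m x) * P - 2 * η m * P ≤ 𝔼 x, X m x * ∏ l ∈ M, (1 - X l x) := by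
      have h2 : 𝔼 x, (X m x * ∏ l ∈ M \ N, (1 - X l x) -
          ∑ i ∈ N, X m x * X i x * ∏ l ∈ M \ N, (1 - X l x)) ≤
          𝔼 x, X m x * ∏ l ∈ M, (1 - X l x) := by
        refine Finset.expect_le_expect fun x _ => ?_
        rw [← Finset.prod_sdiff (Finset.filter_subset (fun l => ¬ Disjoint (U l) (U m)) M),
          ← Finset.sum_mul, ← Finset.mul_sum, ← hN]
        have := mul_le_mul_of_nonneg_left
          (one_sub_sum_le_prod_one_sub N (fun j => X j x) (fun j => h0 j x) fun j => h1 j x)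
          (mul_nonneg (h0 m x) (prod_one_sub_nonneg h1 (M \ N) x))
        linarith
      rw [Finset.expect_sub_distrib, Finset.expect_sum_comm] at h2
      have h3 := Finset.sum_le_sum hpair
      rw [← Finset.sum_mul] at h3
      have h4 : (∑ i ∈ N, 𝔼 x, X m x * X i x) * (2 * P) ≤ η m * (2 * P) :=
        mul_le_mul_of_nonneg_right (hη M m hm) (by linarith)
      have h5 : 𝔼 x, X m x * ∏ l ∈ M \ N, (1 - X l x) =
          (𝔼 x, X m x) * 𝔼 x, ∏ l ∈ M \ N, (1 - X l x) := by
        rw [hMN]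
        exact expect_mul_prod_filter_disjoint (F := fun z => 1 - z) hU (hU m) M
      have h6 : P ≤ 𝔼 x, ∏ l ∈ M \ N, (1 - X l x) :=
        Finset.expect_le_expect fun x _ => prod_one_sub_anti h0 h1 Finset.sdiff_subset x
      have h7 := mul_le_mul_of_nonneg_left h6 hX0
      linarith
    have hsplit : 𝔼 x, ∏ l ∈ insert m M, (1 - X l x) =
        P - 𝔼 x, X m x * ∏ l ∈ M, (1 - X l x) := by
      rw [hP, ← Finset.expect_sub_distrib]
      refine Finset.expect_congr rfl fun x _ => ?_
      rw [Finset.prod_insert hmM]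
      ring
    rw [hsplit, Finset.sum_insert hmM, neg_add, Real.exp_add]
    calc P - 𝔼 x, X m x * ∏ l ∈ M, (1 - X l x)
        ≤ (-((𝔼 x, X m x) - 2 * η m) + 1) * P := by linarith
      _ ≤ Real.exp (-((𝔼 x, X m x) - 2 * η m)) * P :=
          mul_le_mul_of_nonneg_right (Real.add_one_le_exp _) hP0
      _ ≤ _ := mul_le_mul_of_nonneg_left ih (Real.exp_pos _).le

end Avoid

/-! ### Counting in read-`κ` families of sets -/

section Counting

variable {n : ℕ} {ι : Type*} [Fintype ι] {V : ι → Finset (Fin n)} {κ W : ℕ}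

theorem sum_card_inter_le_of_read
    (hr : ∀ i, (Finset.univ.filter fun j => i ∈ V j).card ≤ κ) (J : Finset ι)
    (R : Finset (Fin n)) : ∑ j ∈ J, (V j ∩ R).card ≤ κ * R.card := by
  classical
  calc ∑ j ∈ J, (V j ∩ R).card = ∑ j ∈ J, ∑ i ∈ R, if i ∈ V j then 1 else 0 :=
        Finset.sum_congr rfl fun j _ => by
          rw [Finset.inter_comm, ← Finset.filter_mem_eq_inter, Finset.card_filter]
    _ = ∑ i ∈ R, ∑ j ∈ J, if i ∈ V j then 1 else 0 := Finset.sum_comm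
    _ ≤ ∑ _i ∈ R, κ := Finset.sum_le_sum fun i _ => by
        rw [← Finset.card_filter]
        exact (Finset.card_le_card (Finset.filter_subset_filter _ (Finset.subset_univ J))).trans
          (hr i)
    _ = κ * R.card := by rw [Finset.sum_const, smul_eq_mul, mul_comm]

theorem sum_card_sdiff_le_of_read
    (hr : ∀ i, (Finset.univ.filter fun j => i ∈ V j).card ≤ κ) (J : Finset ι)
    (R : Finset (Fin n)) : ∑ j ∈ J, (V j \ R).card ≤ κ * (J.biUnion V \ R).card := by
  refine le_trans (Finset.sum_le_sum fun j hj => Finset.card_le_card fun i hi => ?_)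
    (sum_card_inter_le_of_read hr J (J.biUnion V \ R))
  have h := Finset.mem_sdiff.1 hi
  exact Finset.mem_inter.2 ⟨h.1, Finset.mem_sdiff.2 ⟨Finset.mem_biUnion.2 ⟨j, hj, h.1⟩, h.2⟩⟩

/-- If a product of factors `1 + c exp (-|V l \ R| / (2 κ))` ranges over not too many sets of size
at least `v`, then it is at most `exp (θ r)`, since only few sets have half of their elements
in `R`. -/
theorem prod_one_add_exp_le
    (hr : ∀ i, (Finset.univ.filter fun j => i ∈ V j).card ≤ κ) (hκ : 0 < κ) {v : ℕ} (hv : 0 < v)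
    (hvV : ∀ j, v ≤ (V j).card) {c θ : ℝ} (hc : 0 ≤ c)
    (hθ : 2 * κ * Real.log (1 + c) / v + κ ^ 2 * W * (c * Real.exp (-(v / (4 * κ)))) ≤ θ)
    {r : ℕ} {N : Finset ι} {R : Finset (Fin n)} (hR : R.card ≤ r)
    (hN : N.card ≤ r * (κ ^ 2 * W)) :
    ∏ l ∈ N, (1 + c * Real.exp (-((V l \ R).card / (2 * κ)))) ≤ Real.exp (θ * r) := by
  have hκ' : (0 : ℝ) < κ := by exact_mod_cast hκ
  have hv' : (0 : ℝ) < v := by exact_mod_cast hv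
  have hlog : 0 ≤ Real.log (1 + c) := Real.log_nonneg (by linarith)
  set e := Real.exp (-(v / (4 * κ)) : ℝ) with he
  have hone : ∀ l, 1 + c * Real.exp (-((V l \ R).card / (2 * κ))) ≤
      Real.exp (2 * Real.log (1 + c) / v * (V l ∩ R).card + c * e) := fun l => by
    have hsum : ((V l \ R).card : ℝ) + (V l ∩ R).card = (V l).card := by
      exact_mod_cast Finset.card_sdiff_add_card_inter (V l) R
    have hvl : (v : ℝ) ≤ (V l).card := by exact_mod_cast hvV l
    by_cases hbig : (v : ℝ) ≤ 2 * (V l ∩ R).card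
    · calc 1 + c * Real.exp (-((V l \ R).card / (2 * κ)))
          ≤ 1 + c * 1 := by
            gcongr
            exact Real.exp_le_one_iff.2 (neg_nonpos.2 (by positivity))
        _ = Real.exp (Real.log (1 + c)) := by rw [Real.exp_log (by linarith), mul_one]
        _ ≤ _ := by
            refine Real.exp_le_exp.2 ?_
            have h1 : Real.log (1 + c) ≤ 2 * Real.log (1 + c) / v * (V l ∩ R).card := by
              rw [div_mul_eq_mul_div, le_div_iff₀ hv']
              nlinarith
            have : 0 ≤ c * e := mul_nonneg hc (Real.exp_pos _).le
            linarith
    · push Not at hbig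
      calc 1 + c * Real.exp (-((V l \ R).card / (2 * κ)))
          ≤ 1 + c * e := by
            gcongr
            rw [he]
            refine Real.exp_le_exp.2 (neg_le_neg ?_)
            rw [div_le_div_iff₀ (by positivity) (by positivity)]
            nlinarith
        _ ≤ Real.exp (c * e) := by rw [add_comm]; exact Real.add_one_le_exp _
        _ ≤ _ := by
            refine Real.exp_le_exp.2 (le_add_of_nonneg_left ?_)
            positivity
  refine (Finset.prod_le_prod (fun l _ => by positivity) fun l _ => hone l).trans ?_
  rw [← Real.exp_sum, Finset.sum_add_distrib, ← Finset.mul_sum, Finset.sum_const, nsmul_eq_mul]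
  refine Real.exp_le_exp.2 ?_
  have h1 : (∑ l ∈ N, ((V l ∩ R).card : ℝ)) ≤ κ * r := by
    have h := (sum_card_inter_le_of_read hr N R).trans (Nat.mul_le_mul_left κ hR)
    exact_mod_cast h
  have h2 : (N.card : ℝ) ≤ r * (κ ^ 2 * W) := by exact_mod_cast hN
  have h3 : 2 * Real.log (1 + c) / v * ∑ l ∈ N, ((V l ∩ R).card : ℝ) ≤
      2 * Real.log (1 + c) / v * (κ * r) := mul_le_mul_of_nonneg_left h1 (by positivity)
  have h4 : (N.card : ℝ) * (c * e) ≤ r * (κ ^ 2 * W) * (c * e) :=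
    mul_le_mul_of_nonneg_right h2 (mul_nonneg hc (Real.exp_pos _).le)
  calc _ ≤ 2 * Real.log (1 + c) / v * (κ * r) + r * (κ ^ 2 * W) * (c * e) := add_le_add h3 h4
    _ = (2 * κ * Real.log (1 + c) / v + κ ^ 2 * W * (c * e)) * r := by ring
    _ ≤ θ * r := mul_le_mul_of_nonneg_right hθ (Nat.cast_nonneg r)

end Counting

/-! ### Fresh terms -/

section Fresh

variable {n : ℕ} {ι : Type*} [Fintype ι] [LinearOrder ι]

/-- The terms preceding `t m` that have at most `a` variables outside `t m`, so that they are
likely to be satisfied when `t m` is. -/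
def closeTo (t : ι → Term n) (a : ℕ) (m : ι) : Finset ι :=
  Finset.univ.filter fun i => i < m ∧ ((t i).vars \ (t m).vars).card ≤ a

/-- The indicator of the event that the term `t m` is fresh: it is satisfied, and no earlier
term close to it is. -/
noncomputable def freshInd (t : ι → Term n) (a : ℕ) (m : ι) (x : Cube n) : ℝ :=
  (t m).ind x * ∏ i ∈ closeTo t a m, (1 - (t i).ind x)

/-- The variables on which the freshness of the term `t m` depends. -/
def freshVars (t : ι → Term n) (a : ℕ) (m : ι) : Finset (Fin n) :=
  (t m).vars ∪ (closeTo t a m).biUnion fun i => (t i).vars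

variable (t : ι → Term n) (a : ℕ)

theorem freshInd_eq_zero_or_one (m : ι) (x : Cube n) :
    freshInd t a m x = 0 ∨ freshInd t a m x = 1 := by
  unfold freshInd
  by_cases h : ∃ i ∈ closeTo t a m, (t i).Sat x
  · obtain ⟨i, hi, hx⟩ := h
    left
    rw [Finset.prod_eq_zero hi (by simp [Term.ind, hx]), mul_zero]
  · push Not at h
    rw [Finset.prod_eq_one fun i hi => by simp [Term.ind, h i hi], mul_one]
    unfold Term.ind
    split_ifs <;> simp

theorem freshInd_nonneg (m : ι) (x : Cube n) : 0 ≤ freshInd t a m x := by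
  rcases freshInd_eq_zero_or_one t a m x with h | h <;> simp [h]

theorem freshInd_le_one (m : ι) (x : Cube n) : freshInd t a m x ≤ 1 := by
  rcases freshInd_eq_zero_or_one t a m x with h | h <;> simp [h]

theorem freshInd_le_ind (m : ι) (x : Cube n) : freshInd t a m x ≤ (t m).ind x :=
  mul_le_of_le_one_right ((t m).ind_nonneg x) (Finset.prod_le_one
    (fun i _ => sub_nonneg.2 ((t i).ind_le_one x)) fun i _ => by linarith [(t i).ind_nonneg x])

theorem freshInd_mul_eq_zero {m i : ι} (hi : i ∈ closeTo t a m) (x : Cube n) :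
    freshInd t a m x * freshInd t a i x = 0 := by
  unfold freshInd
  rw [← Finset.mul_prod_erase _ _ hi]
  unfold Term.ind
  split_ifs <;> simp

theorem dependsOn_freshInd (m : ι) :
    DependsOn (freshInd t a m) (freshVars t a m : Set (Fin n)) := by
  unfold freshVars freshInd
  rw [Finset.coe_union]
  refine dependsOn_mul (t m).dependsOn_ind (dependsOn_prod _ fun i hi x y hxy => ?_)
  rw [(t i).dependsOn_ind fun j hj => hxy j (Finset.mem_coe.2 (Finset.mem_biUnion.2 ⟨i, hi, hj⟩))]

/-- Some term is satisfied if and only if some term is fresh. -/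
theorem prod_one_sub_freshInd (x : Cube n) :
    ∏ m, (1 - freshInd t a m x) = ∏ m, (1 - (t m).ind x) := by
  classical
  by_cases h : ∃ m, (t m).Sat x
  · -- the first satisfied term is fresh
    obtain ⟨m, hm, hmin⟩ := Finset.exists_min_image
      (Finset.univ.filter fun m => (t m).Sat x) id (by
        obtain ⟨m, hm⟩ := h
        exact ⟨m, by simpa using hm⟩)
    have hm' : (t m).Sat x := (Finset.mem_filter.1 hm).2
    have hfresh : freshInd t a m x = 1 := by
      unfold freshInd
      rw [Finset.prod_eq_one fun i hi => ?_]
      · simp [Term.ind, hm']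
      · have hlt := (Finset.mem_filter.1 hi).2.1
        have : ¬ (t i).Sat x := fun hx =>
          absurd (hmin i (by simpa using hx)) (not_le.2 hlt)
        simp [Term.ind, this]
    rw [Finset.prod_eq_zero (Finset.mem_univ m) (by rw [hfresh, sub_self]),
      Finset.prod_eq_zero (Finset.mem_univ m) (by simp [Term.ind, hm'])]
  · push Not at h
    refine Finset.prod_congr rfl fun m _ => ?_
    simp [freshInd, Term.ind, h]

variable {t a} {κ v W : ℕ}

theorem card_closeTo_mul_le (hr : ∀ i, (Finset.univ.filter fun j => i ∈ (t j).vars).card ≤ κ)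
    (hv : ∀ j, v ≤ (t j).vars.card) (hW : ∀ j, (t j).vars.card ≤ W) (m : ι) :
    (closeTo t a m).card * (v - a) ≤ κ * W := by
  calc (closeTo t a m).card * (v - a) ≤ ∑ i ∈ closeTo t a m, ((t i).vars ∩ (t m).vars).card := by
        rw [← smul_eq_mul, ← Finset.sum_const]
        refine Finset.sum_le_sum fun i hi => ?_
        have h1 := Finset.card_sdiff_add_card_inter (t i).vars (t m).vars
        have h2 := (Finset.mem_filter.1 hi).2.2
        have h3 := hv i
        omega
    _ ≤ κ * (t m).vars.card := sum_card_inter_le_of_read hr _ _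
    _ ≤ κ * W := Nat.mul_le_mul_left _ (hW m)

theorem card_freshVars_le (hr : ∀ i, (Finset.univ.filter fun j => i ∈ (t j).vars).card ≤ κ)
    (hv : ∀ j, v ≤ (t j).vars.card) (hW : ∀ j, (t j).vars.card ≤ W) (hva : a * (κ + 1) ≤ v)
    (hκ : 0 < κ) (m : ι) : (freshVars t a m).card ≤ 2 * W := by
  have h1 : freshVars t a m ⊆
      (t m).vars ∪ (closeTo t a m).biUnion fun i => (t i).vars \ (t m).vars := fun x hx => by
    simp only [freshVars, Finset.mem_union, Finset.mem_biUnion, Finset.mem_sdiff] at hx ⊢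
    by_cases h : x ∈ (t m).vars <;> simp_all
  have h2 : ((closeTo t a m).biUnion fun i => (t i).vars \ (t m).vars).card ≤
      (closeTo t a m).card * a :=
    Finset.card_biUnion_le_card_mul _ _ _ fun i hi => (Finset.mem_filter.1 hi).2.2
  have h3 := card_closeTo_mul_le (a := a) hr hv hW m
  have h4 : a * κ ≤ v - a := by
    have : a * (κ + 1) = a * κ + a := by ring
    omega
  have h5 : (closeTo t a m).card * a ≤ W := by
    have : (closeTo t a m).card * (a * κ) ≤ κ * W := (Nat.mul_le_mul_left _ h4).trans h3
    refine Nat.le_of_mul_le_mul_left ?_ hκ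
    calc κ * ((closeTo t a m).card * a) = (closeTo t a m).card * (a * κ) := by ring
      _ ≤ κ * W := this
  have h6 := (Finset.card_le_card h1).trans (Finset.card_union_le _ _)
  have h7 := hW m
  omega

theorem card_filter_not_disjoint_le
    (hr : ∀ i, (Finset.univ.filter fun j => i ∈ (t j).vars).card ≤ κ)
    (hv : ∀ j, v ≤ (t j).vars.card) (hW : ∀ j, (t j).vars.card ≤ W) (hva : a < v)
    (M : Finset ι) (R : Finset (Fin n)) :
    (M.filter fun l => ¬ Disjoint (freshVars t a l) R).card ≤ R.card * (κ ^ 2 * W) := by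
  have h1 : (M.filter fun l => ¬ Disjoint (freshVars t a l) R) ⊆
      R.biUnion fun x => (Finset.univ.filter fun j => x ∈ (t j).vars).biUnion fun i =>
        (t i).vars.biUnion fun y => Finset.univ.filter fun l => y ∈ (t l).vars := fun l hl => by
    obtain ⟨x, hx, hxR⟩ := Finset.not_disjoint_iff.1 (Finset.mem_filter.1 hl).2
    simp only [Finset.mem_biUnion, Finset.mem_filter, Finset.mem_univ, true_and]
    refine ⟨x, hxR, ?_⟩
    rcases Finset.mem_union.1 hx with h | h
    · exact ⟨l, h, x, h, h⟩
    · obtain ⟨i, hi, hxi⟩ := Finset.mem_biUnion.1 h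
      obtain ⟨y, hy⟩ : ((t i).vars ∩ (t l).vars).Nonempty := by
        rw [← Finset.card_pos]
        have h1 := Finset.card_sdiff_add_card_inter (t i).vars (t l).vars
        have h2 := (Finset.mem_filter.1 hi).2.2
        have h3 := hv i
        omega
      exact ⟨i, hxi, y, (Finset.mem_inter.1 hy).1, (Finset.mem_inter.1 hy).2⟩
  refine (Finset.card_le_card h1).trans (Finset.card_biUnion_le_card_mul _ _ _ fun x _ => ?_)
  calc _ ≤ (Finset.univ.filter fun j => x ∈ (t j).vars).card * (W * κ) :=
        Finset.card_biUnion_le_card_mul _ _ _ fun i _ =>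
          (Finset.card_biUnion_le_card_mul _ _ _ fun y _ => hr y).trans
            (Nat.mul_le_mul_right _ (hW i))
    _ ≤ κ * (W * κ) := Nat.mul_le_mul_right _ (hr x)
    _ = κ ^ 2 * W := by ring

end Fresh

/-! ### Exponential moments of the number of fresh terms -/

section Moment

variable {n : ℕ} {ι : Type*} [Fintype ι]

/-- The indicator of the event that all literals of the terms `t j`, `j ∈ J`, on variables
outside `R` are satisfied. -/
noncomputable def offInd (t : ι → Term n) (J : Finset ι) (R : Finset (Fin n)) (x : Cube n) : ℝ :=
  open Classical in if ∀ j ∈ J, ∀ i ∈ (t j).vars \ R, t j i = some (x i) then 1 else 0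

theorem offInd_nonneg (t : ι → Term n) (J : Finset ι) (R : Finset (Fin n)) (x : Cube n) :
    0 ≤ offInd t J R x := by
  unfold offInd; split_ifs <;> norm_num

theorem prod_ind_le_offInd (t : ι → Term n) (J : Finset ι) (R : Finset (Fin n)) (x : Cube n) :
    ∏ j ∈ J, (t j).ind x ≤ offInd t J R x := by
  by_cases h : ∀ j ∈ J, (t j).Sat x
  · rw [Finset.prod_eq_one fun j hj => by simp [Term.ind, h j hj], offInd,
      if_pos fun j hj i hi => h j hj i (Finset.mem_sdiff.1 hi).1]
  · push Not at h
    obtain ⟨j, hj, hx⟩ := h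
    rw [Finset.prod_eq_zero hj (by simp [Term.ind, hx])]
    exact offInd_nonneg t J R x

theorem dependsOn_offInd (t : ι → Term n) (J : Finset ι) (R : Finset (Fin n)) :
    DependsOn (offInd t J R)
      ((J.biUnion (fun j => (t j).vars) \ R : Finset (Fin n)) : Set (Fin n)) :=
  fun x y hxy => by
    unfold offInd
    congr 1
    refine propext (forall₂_congr fun j hj => forall₂_congr fun i hi => ?_)
    have h := Finset.mem_sdiff.1 hi
    rw [hxy i (Finset.mem_coe.2 (Finset.mem_sdiff.2 ⟨Finset.mem_biUnion.2 ⟨j, hj, h.1⟩, h.2⟩))]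

theorem expect_offInd_le (t : ι → Term n) (J : Finset ι) (R : Finset (Fin n)) :
    𝔼 x, offInd t J R x ≤ (1 / 2) ^ (J.biUnion (fun j => (t j).vars) \ R).card := by
  classical
  unfold offInd
  refine le_of_eq_of_le (Finset.expect_congr rfl fun x _ => ?_)
    (expect_indicator_le _ (fun x => ∀ j ∈ J, ∀ i ∈ (t j).vars \ R, t j i = some (x i)) ?_)
  · congr 1
  · intro x y hx hy i hi
    obtain ⟨hi1, hi2⟩ := Finset.mem_sdiff.1 hi
    obtain ⟨j, hj, hij⟩ := Finset.mem_biUnion.1 hi1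
    have hi' := Finset.mem_sdiff.2 ⟨hij, hi2⟩
    exact Option.some_injective _ ((hx j hj i hi').symm.trans (hy j hj i hi'))

theorem half_pow_mul_exp_le {θ : ℝ} (hθ : θ ≤ 1 / 16) (r : ℕ) :
    (1 / 2 : ℝ) ^ r * Real.exp (θ * r) ≤ Real.exp (-(r / 8)) * Real.exp (-(r / 2)) := by
  have h2 : (1 / 2 : ℝ) = Real.exp (-Real.log 2) := by
    rw [Real.exp_neg, Real.exp_log two_pos, one_div]
  rw [h2, ← Real.exp_nat_mul, ← Real.exp_add, ← Real.exp_add]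
  refine Real.exp_le_exp.2 ?_
  have := Real.log_two_gt_d9
  have hr : (0 : ℝ) ≤ r := Nat.cast_nonneg r
  nlinarith

variable {V : ι → Finset (Fin n)} {κ : ℕ}

theorem exp_neg_card_biUnion_le
    (hr : ∀ i, (Finset.univ.filter fun j => i ∈ V j).card ≤ κ) (hκ : 0 < κ) (J : Finset ι)
    (R : Finset (Fin n)) :
    Real.exp (-(((J.biUnion V \ R).card : ℝ) / 2)) ≤
      ∏ j ∈ J, Real.exp (-((V j \ R).card / (2 * κ))) := by
  rw [← Real.exp_sum]
  refine Real.exp_le_exp.2 ?_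
  have hκ' : (0 : ℝ) < κ := by exact_mod_cast hκ
  have h : (∑ j ∈ J, ((V j \ R).card : ℝ)) ≤ κ * (J.biUnion V \ R).card := by
    exact_mod_cast sum_card_sdiff_le_of_read hr J R
  rw [Finset.sum_neg_distrib, ← Finset.sum_div]
  refine neg_le_neg ((div_le_iff₀ (by positivity)).2 ?_)
  linarith

variable [LinearOrder ι]

theorem prod_one_add_fresh_le_sum (t : ι → Term n) (a : ℕ) {c : ℝ} (hc : 0 ≤ c) (N : Finset ι)
    (x : Cube n) : ∏ l ∈ N, (1 + c * freshInd t a l x) ≤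
      ∑ J ∈ N.powerset, c ^ J.card * ∏ j ∈ J, (t j).ind x := by
  rw [Finset.prod_one_add]
  refine Finset.sum_le_sum fun J _ => ?_
  rw [Finset.prod_mul_distrib, Finset.prod_const]
  exact mul_le_mul_of_nonneg_left (Finset.prod_le_prod (fun j _ => freshInd_nonneg t a j x)
    fun j _ => freshInd_le_ind t a j x) (pow_nonneg hc _)

theorem prod_one_add_fresh_nonneg (t : ι → Term n) (a : ℕ) {c : ℝ} (hc : 0 ≤ c) (M : Finset ι)
    (x : Cube n) : 0 ≤ ∏ l ∈ M, (1 + c * freshInd t a l x) :=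
  Finset.prod_nonneg fun l _ => by have := mul_nonneg hc (freshInd_nonneg t a l x); linarith

theorem prod_one_add_fresh_mono (t : ι → Term n) (a : ℕ) {c : ℝ} (hc : 0 ≤ c) {M M' : Finset ι}
    (hM : M' ⊆ M) (x : Cube n) :
    ∏ l ∈ M', (1 + c * freshInd t a l x) ≤ ∏ l ∈ M, (1 + c * freshInd t a l x) :=
  Finset.prod_le_prod_of_subset_of_one_le hM
    (fun l _ => by have := mul_nonneg hc (freshInd_nonneg t a l x); linarith)
    fun l _ _ => by have := mul_nonneg hc (freshInd_nonneg t a l x); linarith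

/-- A family of terms of width between `v` and `W`, each variable occurring in at most `κ` of
them. -/
structure IsSpread (t : ι → Term n) (κ v W : ℕ) : Prop where
  read : ∀ i, (Finset.univ.filter fun j => i ∈ (t j).vars).card ≤ κ
  le_card : ∀ j, v ≤ (t j).vars.card
  card_le : ∀ j, (t j).vars.card ≤ W

variable {t : ι → Term n} {a v W : ℕ} {c θ : ℝ}

/-- Conditioning on an event that depends on the variables in `R` raises the exponential moment of
the number of fresh terms by a factor of at most `exp (θ |R|)`. -/
theorem expect_mul_prod_fresh_le (ht : IsSpread t κ v W) (hκ : 0 < κ) (hv : 0 < v) (hva : a < v)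
    (hc : 0 ≤ c)
    (hθ : 2 * κ * Real.log (1 + c) / v + κ ^ 2 * W * (c * Real.exp (-(v / (4 * κ)))) ≤ θ)
    (hθ1 : θ ≤ 1 / 16) (M : Finset ι) :
    ∀ (R : Finset (Fin n)) (g : Cube n → ℝ), (∀ x, 0 ≤ g x) → DependsOn g (R : Set (Fin n)) →
      𝔼 x, g x * ∏ l ∈ M, (1 + c * freshInd t a l x) ≤
        (𝔼 x, g x) * Real.exp (θ * R.card) * 𝔼 x, ∏ l ∈ M, (1 + c * freshInd t a l x) := by
  have hθ0 : 0 ≤ θ := le_trans (by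
    have := Real.log_nonneg (by linarith : (1 : ℝ) ≤ 1 + c)
    positivity) hθ
  induction M using Finset.strongInduction with
  | H M ih =>
    intro R g g0 gR
    set N := M.filter fun l => ¬ Disjoint (freshVars t a l) R with hN
    have hMN : M \ N = M.filter fun l => Disjoint (freshVars t a l) R := by
      ext l; simp only [hN, Finset.mem_sdiff, Finset.mem_filter]; tauto
    set Q := 𝔼 x, ∏ l ∈ M \ N, (1 + c * freshInd t a l x) with hQ
    set P := 𝔼 x, ∏ l ∈ M, (1 + c * freshInd t a l x) with hP
    have hQ0 : 0 ≤ Q := Finset.expect_nonneg fun x _ => prod_one_add_fresh_nonneg t a hc _ x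
    have hQP : Q ≤ P := Finset.expect_le_expect fun x _ =>
      prod_one_add_fresh_mono t a hc Finset.sdiff_subset x
    have hg0 : 0 ≤ 𝔼 x, g x := Finset.expect_nonneg fun x _ => g0 x
    rcases N.eq_empty_or_nonempty with hNe | hNe
    · have h1 : 𝔼 x, g x * ∏ l ∈ M, (1 + c * freshInd t a l x) = (𝔼 x, g x) * P := by
        have hM : M = M.filter fun l => Disjoint (freshVars t a l) R := by
          rw [← hMN, hNe, Finset.sdiff_empty]
        rw [hP, hM]
        exact expect_mul_prod_filter_disjoint (F := fun z => 1 + c * z)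
          (fun l => dependsOn_freshInd t a l) gR M
      rw [h1]
      refine mul_le_mul_of_nonneg_right (le_mul_of_one_le_right hg0 ?_) (hQ0.trans hQP)
      exact Real.one_le_exp (by positivity)
    · have hterm : ∀ J ∈ N.powerset, 𝔼 x, g x * (offInd t J R x *
          ∏ l ∈ M \ N, (1 + c * freshInd t a l x)) ≤
          (𝔼 x, g x) * ((∏ j ∈ J, Real.exp (-(((t j).vars \ R).card / (2 * κ)))) * Q) := by
        intro J _
        rw [expect_mul_of_dependsOn (B := (R : Set (Fin n))ᶜ) gR ?_ disjoint_compl_right]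
        · refine mul_le_mul_of_nonneg_left ?_ hg0
          refine (ih (M \ N) (Finset.sdiff_ssubset (Finset.filter_subset _ _) hNe) _ _
            (offInd_nonneg t J R) (dependsOn_offInd t J R)).trans ?_
          refine mul_le_mul_of_nonneg_right ?_ hQ0
          calc _ ≤ (1 / 2 : ℝ) ^ (J.biUnion (fun j => (t j).vars) \ R).card *
                Real.exp (θ * (J.biUnion (fun j => (t j).vars) \ R).card) :=
                mul_le_mul_of_nonneg_right (expect_offInd_le t J R) (Real.exp_pos _).le
            _ ≤ _ := half_pow_mul_exp_le hθ1 _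
            _ ≤ 1 * Real.exp (-((J.biUnion (fun j => (t j).vars) \ R).card / 2)) :=
                mul_le_mul_of_nonneg_right
                  (Real.exp_le_one_iff.2 (neg_nonpos.2 (by positivity))) (Real.exp_pos _).le
            _ ≤ _ := by
                rw [one_mul]
                exact exp_neg_card_biUnion_le ht.read hκ J R
        · refine fun x y hxy => ?_
          have h1 := dependsOn_offInd t J R (x := x) (y := y) fun i hi =>
            hxy i (by simpa using fun h => (Finset.mem_sdiff.1 (Finset.mem_coe.1 hi)).2 h)
          have h2 : ∀ l ∈ M \ N, freshInd t a l x = freshInd t a l y := fun l hl => by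
            rw [hMN] at hl
            exact dependsOn_freshInd t a l fun i hi => hxy i fun hiR =>
              Finset.disjoint_left.1 (Finset.mem_filter.1 hl).2 hi hiR
          simp only [h1]
          congr 1
          exact Finset.prod_congr rfl fun l hl => by rw [h2 l hl]
      calc 𝔼 x, g x * ∏ l ∈ M, (1 + c * freshInd t a l x)
          ≤ 𝔼 x, ∑ J ∈ N.powerset, c ^ J.card * (g x * (offInd t J R x *
              ∏ l ∈ M \ N, (1 + c * freshInd t a l x))) := by
            refine Finset.expect_le_expect fun x _ => ?_
            have h1 := prod_one_add_fresh_le_sum t a hc N x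
            have h2 : ∑ J ∈ N.powerset, c ^ J.card * ∏ j ∈ J, (t j).ind x ≤
                ∑ J ∈ N.powerset, c ^ J.card * offInd t J R x :=
              Finset.sum_le_sum fun J _ =>
                mul_le_mul_of_nonneg_left (prod_ind_le_offInd t J R x) (pow_nonneg hc _)
            have h3 := mul_le_mul_of_nonneg_left (h1.trans h2)
              (mul_nonneg (g0 x) (prod_one_add_fresh_nonneg t a hc (M \ N) x))
            rw [← Finset.prod_sdiff (Finset.filter_subset
              (fun l => ¬ Disjoint (freshVars t a l) R) M), ← hN, ← mul_assoc]
            refine h3.trans (le_of_eq ?_)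
            rw [Finset.mul_sum]
            exact Finset.sum_congr rfl fun J _ => by ring
        _ = ∑ J ∈ N.powerset, c ^ J.card * 𝔼 x, g x * (offInd t J R x *
              ∏ l ∈ M \ N, (1 + c * freshInd t a l x)) := by
            rw [Finset.expect_sum_comm]
            exact Finset.sum_congr rfl fun J _ => by rw [Finset.mul_expect]
        _ ≤ ∑ J ∈ N.powerset, c ^ J.card * ((𝔼 x, g x) *
              ((∏ j ∈ J, Real.exp (-(((t j).vars \ R).card / (2 * κ)))) * Q)) :=
            Finset.sum_le_sum fun J hJ =>
              mul_le_mul_of_nonneg_left (hterm J hJ) (pow_nonneg hc _)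
        _ = (𝔼 x, g x) *
              (∏ l ∈ N, (1 + c * Real.exp (-(((t l).vars \ R).card / (2 * κ))))) * Q := by
            rw [Finset.prod_one_add, Finset.mul_sum, Finset.sum_mul]
            refine Finset.sum_congr rfl fun J _ => ?_
            rw [Finset.prod_mul_distrib, Finset.prod_const]
            ring
        _ ≤ (𝔼 x, g x) * Real.exp (θ * R.card) * P := by
            refine mul_le_mul (mul_le_mul_of_nonneg_left ?_ hg0) hQP hQ0
              (mul_nonneg hg0 (Real.exp_pos _).le)
            exact prod_one_add_exp_le ht.read hκ hv ht.le_card hc hθ le_rfl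
              (card_filter_not_disjoint_le ht.read ht.le_card ht.card_le hva M R)

/-- One step of the moment computation: a term that is fresh makes later fresh terms hardly more
likely, because all satisfied terms meeting it have many variables outside it. -/
theorem expect_fresh_mul_prod_fresh_le (ht : IsSpread t κ v W) (hκ : 0 < κ) (hv : 0 < v)
    (hva : a * (κ + 1) ≤ v) (hva' : a < v) (hc : 0 ≤ c)
    (hθ : 2 * κ * Real.log (1 + c) / v + κ ^ 2 * W * (c * Real.exp (-(v / (4 * κ)))) ≤ θ)
    (hθ1 : θ ≤ 1 / 16) {M : Finset ι} {m : ι} (hm : ∀ i ∈ M, i < m) :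
    𝔼 x, freshInd t a m x * ∏ l ∈ M, (1 + c * freshInd t a l x) ≤
      ((𝔼 x, freshInd t a m x) +
        (1 / 2) ^ (t m).vars.card * Real.exp (3 * θ * W - a / 8)) *
        𝔼 x, ∏ l ∈ M, (1 + c * freshInd t a l x) := by
  have hθ0 : 0 ≤ θ := le_trans (by
    have := Real.log_nonneg (by linarith : (1 : ℝ) ≤ 1 + c)
    positivity) hθ
  set N := M.filter fun l => ¬ Disjoint (freshVars t a l) (freshVars t a m) with hN
  have hMN : M \ N = M.filter fun l => Disjoint (freshVars t a l) (freshVars t a m) := by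
    ext l; simp only [hN, Finset.mem_sdiff, Finset.mem_filter]; tauto
  set N' := N \ closeTo t a m with hN'
  set Q := 𝔼 x, ∏ l ∈ M \ N, (1 + c * freshInd t a l x) with hQ
  set P := 𝔼 x, ∏ l ∈ M, (1 + c * freshInd t a l x) with hP
  have hQ0 : 0 ≤ Q := Finset.expect_nonneg fun x _ => prod_one_add_fresh_nonneg t a hc _ x
  have hQP : Q ≤ P := Finset.expect_le_expect fun x _ =>
    prod_one_add_fresh_mono t a hc Finset.sdiff_subset x
  set R := (t m).vars with hR
  have hterm : ∀ J ∈ N'.powerset.erase ∅,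
      𝔼 x, (t m).ind x * offInd t J R x * ∏ l ∈ M \ N, (1 + c * freshInd t a l x) ≤
      (∏ j ∈ J, Real.exp (-(((t j).vars \ R).card / (2 * κ)))) *
        ((1 / 2) ^ R.card * Real.exp (θ * W - a / 8) * Q) := by
    intro J hJ
    obtain ⟨hJne, hJ⟩ := Finset.mem_erase.1 hJ
    obtain ⟨j, hj⟩ := Finset.nonempty_iff_ne_empty.2 hJne
    set B := J.biUnion (fun j => (t j).vars) \ R with hB
    -- the members of `J` precede `m` and are not close to it
    have haB : a ≤ B.card := by
      have h1 := Finset.mem_sdiff.1 (Finset.mem_powerset.1 hJ hj)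
      have h2 : a < ((t j).vars \ R).card := by
        by_contra! h
        exact h1.2 (Finset.mem_filter.2
          ⟨Finset.mem_univ _, hm j (Finset.mem_filter.1 h1.1).1, h⟩)
      refine h2.le.trans (Finset.card_le_card (Finset.sdiff_subset_sdiff ?_ subset_rfl))
      exact fun i hi => Finset.mem_biUnion.2 ⟨j, hj, hi⟩
    have hdisj : Disjoint (R : Set (Fin n)) (B : Set (Fin n)) :=
      Finset.disjoint_coe.2 Finset.disjoint_sdiff
    have hdep := dependsOn_mul (t m).dependsOn_ind (dependsOn_offInd t J R)
    rw [← Finset.coe_union] at hdep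
    refine (expect_mul_prod_fresh_le ht hκ hv hva' hc hθ hθ1 (M \ N) _ _
      (fun x => mul_nonneg ((t m).ind_nonneg x) (offInd_nonneg t J R x)) hdep).trans ?_
    rw [expect_mul_of_dependsOn (t m).dependsOn_ind (dependsOn_offInd t J R) hdisj,
      Term.expect_ind, Finset.card_union_of_disjoint Finset.disjoint_sdiff, ← hR, ← hB]
    have hoff := expect_offInd_le t J R
    rw [← hB] at hoff
    have hoff0 : 0 ≤ 𝔼 x, offInd t J R x := Finset.expect_nonneg fun x _ => offInd_nonneg t J R x
    have hRW : (R.card : ℝ) ≤ W := by exact_mod_cast ht.card_le m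
    calc (1 / 2 : ℝ) ^ R.card * (𝔼 x, offInd t J R x) *
          Real.exp (θ * ((R.card + B.card : ℕ) : ℝ)) * Q
        ≤ (1 / 2 : ℝ) ^ R.card * (1 / 2) ^ B.card * Real.exp (θ * W + θ * B.card) * Q := by
          refine mul_le_mul_of_nonneg_right (mul_le_mul (mul_le_mul_of_nonneg_left hoff
            (by positivity)) (Real.exp_le_exp.2 ?_) (Real.exp_pos _).le (by positivity)) hQ0
          push_cast
          nlinarith
      _ = (1 / 2 : ℝ) ^ R.card * Real.exp (θ * W) *
            ((1 / 2) ^ B.card * Real.exp (θ * B.card)) * Q := by rw [Real.exp_add]; ring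
      _ ≤ (1 / 2 : ℝ) ^ R.card * Real.exp (θ * W) *
            (Real.exp (-(a / 8)) * ∏ j ∈ J, Real.exp (-(((t j).vars \ R).card / (2 * κ)))) * Q := by
          refine mul_le_mul_of_nonneg_right (mul_le_mul_of_nonneg_left ?_ (by positivity)) hQ0
          refine (half_pow_mul_exp_le hθ1 _).trans (mul_le_mul (Real.exp_le_exp.2 ?_)
            (exp_neg_card_biUnion_le ht.read hκ J R) (Real.exp_pos _).le (Real.exp_pos _).le)
          have : (a : ℝ) ≤ B.card := by exact_mod_cast haB
          linarith
      _ = _ := by rw [sub_eq_add_neg, Real.exp_add]; ring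
  have hfresh : ∀ x, freshInd t a m x * ∏ l ∈ N, (1 + c * freshInd t a l x) =
      freshInd t a m x * ∏ l ∈ N', (1 + c * freshInd t a l x) := fun x => by
    by_cases h : freshInd t a m x = 0
    · simp [h]
    · congr 1
      symm
      refine Finset.prod_subset Finset.sdiff_subset fun l hl hl' => ?_
      have hclose : l ∈ closeTo t a m := by
        by_contra h'
        exact hl' (Finset.mem_sdiff.2 ⟨hl, h'⟩)
      rw [(mul_eq_zero.1 (freshInd_mul_eq_zero t a hclose x)).resolve_left h, mul_zero, add_zero]
  have hpoint : ∀ x, freshInd t a m x * ∏ l ∈ M, (1 + c * freshInd t a l x) ≤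
      freshInd t a m x * ∏ l ∈ M \ N, (1 + c * freshInd t a l x) +
      ∑ J ∈ N'.powerset.erase ∅, c ^ J.card *
        ((t m).ind x * offInd t J R x * ∏ l ∈ M \ N, (1 + c * freshInd t a l x)) := fun x => by
    have hZ := prod_one_add_fresh_nonneg t a hc (M \ N) x
    have h1 := prod_one_add_fresh_le_sum t a hc N' x
    rw [← Finset.add_sum_erase _ _ (Finset.empty_mem_powerset N')] at h1
    simp only [Finset.card_empty, pow_zero, Finset.prod_empty, mul_one] at h1
    have h2 : ∑ J ∈ N'.powerset.erase ∅, c ^ J.card * ∏ j ∈ J, (t j).ind x ≤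
        ∑ J ∈ N'.powerset.erase ∅, c ^ J.card * offInd t J R x :=
      Finset.sum_le_sum fun J _ =>
        mul_le_mul_of_nonneg_left (prod_ind_le_offInd t J R x) (pow_nonneg hc _)
    have hS0 : 0 ≤ ∑ J ∈ N'.powerset.erase ∅, c ^ J.card * offInd t J R x :=
      Finset.sum_nonneg fun J _ => mul_nonneg (pow_nonneg hc _) (offInd_nonneg t J R x)
    calc freshInd t a m x * ∏ l ∈ M, (1 + c * freshInd t a l x)
        = (∏ l ∈ M \ N, (1 + c * freshInd t a l x)) *
            (freshInd t a m x * ∏ l ∈ N', (1 + c * freshInd t a l x)) := by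
          rw [← hfresh, ← Finset.prod_sdiff (Finset.filter_subset
            (fun l => ¬ Disjoint (freshVars t a l) (freshVars t a m)) M), ← hN]
          ring
      _ ≤ (∏ l ∈ M \ N, (1 + c * freshInd t a l x)) * (freshInd t a m x +
            (t m).ind x * ∑ J ∈ N'.powerset.erase ∅, c ^ J.card * offInd t J R x) := by
          refine mul_le_mul_of_nonneg_left ?_ hZ
          calc freshInd t a m x * ∏ l ∈ N', (1 + c * freshInd t a l x)
              ≤ freshInd t a m x *
                (1 + ∑ J ∈ N'.powerset.erase ∅, c ^ J.card * offInd t J R x) :=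
                mul_le_mul_of_nonneg_left (by linarith) (freshInd_nonneg t a m x)
            _ ≤ _ := by
                rw [mul_add, mul_one]
                gcongr
                exact freshInd_le_ind t a m x
      _ = _ := by
          rw [mul_add, mul_comm, Finset.mul_sum, Finset.mul_sum]
          congr 1
          exact Finset.sum_congr rfl fun J _ => by ring
  have hprod : ∏ l ∈ N', (1 + c * Real.exp (-(((t l).vars \ R).card / (2 * κ)))) ≤
      Real.exp (θ * ((2 * W : ℕ) : ℝ)) := by
    refine prod_one_add_exp_le ht.read hκ hv ht.le_card hc hθ
      ((ht.card_le m).trans (Nat.le_mul_of_pos_left _ two_pos)) ?_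
    refine (Finset.card_le_card Finset.sdiff_subset).trans
      ((card_filter_not_disjoint_le ht.read ht.le_card ht.card_le hva' M _).trans ?_)
    exact Nat.mul_le_mul_right _
      (card_freshVars_le ht.read ht.le_card ht.card_le hva hκ m)
  have hmain : 𝔼 x, freshInd t a m x * ∏ l ∈ M \ N, (1 + c * freshInd t a l x) =
      (𝔼 x, freshInd t a m x) * Q := by
    rw [hQ, hMN]
    exact expect_mul_prod_filter_disjoint (F := fun z => 1 + c * z)
      (fun l => dependsOn_freshInd t a l) (dependsOn_freshInd t a m) M
  have hX0 : 0 ≤ 𝔼 x, freshInd t a m x := Finset.expect_nonneg fun x _ => freshInd_nonneg t a m x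
  set E := (1 / 2 : ℝ) ^ R.card * Real.exp (θ * W - a / 8) with hE
  have hE0 : 0 ≤ E := by positivity
  calc _ ≤ _ := Finset.expect_le_expect fun x _ => hpoint x
    _ = (𝔼 x, freshInd t a m x) * Q + ∑ J ∈ N'.powerset.erase ∅, c ^ J.card *
          𝔼 x, (t m).ind x * offInd t J R x * ∏ l ∈ M \ N, (1 + c * freshInd t a l x) := by
        rw [Finset.expect_add_distrib, hmain, Finset.expect_sum_comm]
        congr 1
        exact Finset.sum_congr rfl fun J _ => by rw [Finset.mul_expect]
    _ ≤ (𝔼 x, freshInd t a m x) * Q + ∑ J ∈ N'.powerset.erase ∅, c ^ J.card *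
          ((∏ j ∈ J, Real.exp (-(((t j).vars \ R).card / (2 * κ)))) * (E * Q)) := by
        gcongr with J hJ
        exact hterm J hJ
    _ ≤ (𝔼 x, freshInd t a m x) * Q + ∑ J ∈ N'.powerset, c ^ J.card *
          ((∏ j ∈ J, Real.exp (-(((t j).vars \ R).card / (2 * κ)))) * (E * Q)) := by
        refine add_le_add le_rfl
          (Finset.sum_le_sum_of_subset_of_nonneg (Finset.erase_subset _ _) fun J _ _ => ?_)
        positivity
    _ = (𝔼 x, freshInd t a m x) * Q +
          (∏ l ∈ N', (1 + c * Real.exp (-(((t l).vars \ R).card / (2 * κ))))) * (E * Q) := by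
        rw [Finset.prod_one_add, Finset.sum_mul]
        congr 1
        refine Finset.sum_congr rfl fun J _ => ?_
        rw [Finset.prod_mul_distrib, Finset.prod_const]
        ring
    _ ≤ (𝔼 x, freshInd t a m x) * P + Real.exp (θ * ((2 * W : ℕ) : ℝ)) * (E * P) := by
        gcongr
    _ = _ := by
        have : Real.exp (3 * θ * W - a / 8) =
            Real.exp (θ * ((2 * W : ℕ) : ℝ)) * Real.exp (θ * W - a / 8) := by
          rw [← Real.exp_add]
          congr 1
          push_cast
          ring
        rw [this, hE]
        ring

theorem expect_prod_one_add_fresh_le (ht : IsSpread t κ v W) (hκ : 0 < κ) (hv : 0 < v)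
    (hva : a * (κ + 1) ≤ v) (hva' : a < v) (hc : 0 ≤ c)
    (hθ : 2 * κ * Real.log (1 + c) / v + κ ^ 2 * W * (c * Real.exp (-(v / (4 * κ)))) ≤ θ)
    (hθ1 : θ ≤ 1 / 16) (M : Finset ι) :
    𝔼 x, ∏ l ∈ M, (1 + c * freshInd t a l x) ≤
      Real.exp (c * ∑ m ∈ M, ((𝔼 x, freshInd t a m x) +
        (1 / 2) ^ (t m).vars.card * Real.exp (3 * θ * W - a / 8))) := by
  induction M using Finset.induction_on_max with
  | empty => simp
  | insert m M hm ih =>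
    have hmM : m ∉ M := fun h => lt_irrefl _ (hm m h)
    have hstep := expect_fresh_mul_prod_fresh_le ht hκ hv hva hva' hc hθ hθ1 hm
    set y := (𝔼 x, freshInd t a m x) +
        (1 / 2) ^ (t m).vars.card * Real.exp (3 * θ * W - a / 8) with hy
    set P := 𝔼 x, ∏ l ∈ M, (1 + c * freshInd t a l x) with hP
    have hP0 : 0 ≤ P := Finset.expect_nonneg fun x _ => prod_one_add_fresh_nonneg t a hc _ x
    have hsplit : 𝔼 x, ∏ l ∈ insert m M, (1 + c * freshInd t a l x) =
        P + c * 𝔼 x, freshInd t a m x * ∏ l ∈ M, (1 + c * freshInd t a l x) := by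
      rw [hP, Finset.mul_expect, ← Finset.expect_add_distrib]
      refine Finset.expect_congr rfl fun x _ => ?_
      rw [Finset.prod_insert hmM]
      ring
    rw [hsplit, Finset.sum_insert hmM, ← hy, mul_add, Real.exp_add]
    calc _ ≤ P + c * (y * P) := by gcongr
      _ = (c * y + 1) * P := by ring
      _ ≤ Real.exp (c * y) * P := mul_le_mul_of_nonneg_right (Real.add_one_le_exp _) hP0
      _ ≤ _ := mul_le_mul_of_nonneg_left ih (Real.exp_pos _).le

end Moment

section Wide

variable {n : ℕ} {ι : Type*} [Fintype ι] [LinearOrder ι] {t : ι → Term n} {κ v W a : ℕ}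

theorem expect_fresh_mul_fresh_le (t : ι → Term n) (a : ℕ) {i m : ι} (him : i < m) :
    𝔼 x, freshInd t a m x * freshInd t a i x ≤ (1 / 2) ^ (t m).vars.card * (1 / 2) ^ a := by
  by_cases hi : i ∈ closeTo t a m
  · simp only [freshInd_mul_eq_zero t a hi, Finset.expect_const_zero]
    positivity
  · have ha : a ≤ ((t i).vars \ (t m).vars).card := by
      by_contra! h
      exact hi (Finset.mem_filter.2 ⟨Finset.mem_univ _, him, h.le⟩)
    calc 𝔼 x, freshInd t a m x * freshInd t a i x
        ≤ 𝔼 x, (t m).ind x * offInd t {i} (t m).vars x := by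
          refine Finset.expect_le_expect fun x _ => mul_le_mul (freshInd_le_ind t a m x) ?_
            (freshInd_nonneg t a i x) ((t m).ind_nonneg x)
          refine (freshInd_le_ind t a i x).trans ?_
          simpa using prod_ind_le_offInd t {i} (t m).vars x
      _ = (1 / 2) ^ (t m).vars.card * 𝔼 x, offInd t {i} (t m).vars x := by
          rw [expect_mul_of_dependsOn (t m).dependsOn_ind (dependsOn_offInd t {i} _)
            (Finset.disjoint_coe.2 Finset.disjoint_sdiff), Term.expect_ind]
      _ ≤ _ := by
          refine mul_le_mul_of_nonneg_left ?_ (by positivity)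
          refine (expect_offInd_le t {i} _).trans ?_
          rw [Finset.singleton_biUnion]
          exact pow_le_pow_of_le_one (by norm_num) (by norm_num) ha

/-- The expected number of fresh terms is at most logarithmic in the inverse of the probability
that the formula is unsatisfied, up to a negligible error. -/
theorem sum_expect_fresh_le (ht : IsSpread t κ v W) (hκ : 0 < κ) (hva : a * (κ + 1) ≤ v)
    (hva' : a < v) (hpD : 8 * (1 / 2 : ℝ) ^ v * ((2 * W * (κ ^ 2 * W) : ℕ) : ℝ) ≤ 1) {r : ℝ}
    (h : Real.exp (-r) ≤ 𝔼 x, ∏ j, (1 - (t j).ind x)) :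
    ∑ m, 𝔼 x, freshInd t a m x ≤
      r + 2 * (((2 * W * (κ ^ 2 * W) : ℕ) : ℝ) * (1 / 2) ^ a) * ∑ m, (1 / 2) ^ (t m).vars.card := by
  set D : ℝ := ((2 * W * (κ ^ 2 * W) : ℕ) : ℝ) with hDdef
  have hD : ∀ (M : Finset ι) j,
      ((M.filter fun l => ¬ Disjoint (freshVars t a l) (freshVars t a j)).card : ℝ) ≤ D :=
    fun M j => by
      rw [hDdef]
      exact_mod_cast (card_filter_not_disjoint_le ht.read ht.le_card ht.card_le hva' M _).trans
        (Nat.mul_le_mul_right _ (card_freshVars_le ht.read ht.le_card ht.card_le hva hκ j))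
  have hp : ∀ j, 𝔼 x, freshInd t a j x ≤ (1 / 2 : ℝ) ^ v := fun j => by
    refine (Finset.expect_le_expect fun x _ => freshInd_le_ind t a j x).trans ?_
    rw [Term.expect_ind]
    exact pow_le_pow_of_le_one (by norm_num) (by norm_num) (ht.le_card j)
  have key := expect_prod_one_sub_le_exp (X := freshInd t a) (U := freshVars t a)
    (freshInd_nonneg t a) (freshInd_le_one t a) (dependsOn_freshInd t a) hp hD hpD
    (η := fun m => D * ((1 / 2) ^ (t m).vars.card * (1 / 2) ^ a)) (fun M m hm => by
      refine (Finset.sum_le_sum fun i hi =>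
        expect_fresh_mul_fresh_le t a (hm i (Finset.mem_filter.1 hi).1)).trans ?_
      rw [Finset.sum_const, nsmul_eq_mul]
      exact mul_le_mul_of_nonneg_right (hD M m) (by positivity)) Finset.univ
  simp only [prod_one_sub_freshInd] at key
  have h2 := Real.exp_le_exp.1 (h.trans key)
  rw [Finset.sum_sub_distrib] at h2
  have h3 : ∑ m, 2 * (D * ((1 / 2 : ℝ) ^ (t m).vars.card * (1 / 2) ^ a)) =
      2 * (D * (1 / 2) ^ a) * ∑ m, (1 / 2) ^ (t m).vars.card := by
    rw [Finset.mul_sum]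
    exact Finset.sum_congr rfl fun m _ => by ring
  rw [h3] at h2
  linarith

/-- If all terms have widths between `q ^ 9` and `q ^ 10`, and `q` is large compared to the read
number, then the number of fresh terms has an exponential moment that is polynomial in the
inverse of the probability that the formula is unsatisfied. -/
theorem expect_prod_one_add_fresh_le_of_unsat {q : ℕ} (ht : IsSpread t κ (q ^ 9) (q ^ 10))
    (hκ : 0 < κ) (hκq : 20 * κ ≤ q) (hq : 4000 ≤ q) {r : ℝ}
    (h : Real.exp (-r) ≤ 𝔼 x, ∏ j, (1 - (t j).ind x)) :
    𝔼 x, ∏ l, (1 + 63 * freshInd t (q ^ 3) l x) ≤ Real.exp (189 * r) := by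
  have hqR : (4000 : ℝ) ≤ q := by exact_mod_cast hq
  have hq0 : (0 : ℝ) < q := by linarith
  have hκR : (20 : ℝ) * κ ≤ q := by exact_mod_cast hκq
  have hκ1 : (1 : ℝ) ≤ κ := by exact_mod_cast hκ
  have hκ0 : (0 : ℝ) < κ := by linarith
  have hq1 : 1 < q := by omega
  have hpow2 : ∀ e : ℕ, (q : ℝ) ^ e ≤ 2 ^ (e * q) := fun e => by
    rw [mul_comm, pow_mul]
    exact pow_le_pow_left₀ hq0.le (by exact_mod_cast (Nat.lt_two_pow_self (n := q)).le) _
  have hva : q ^ 3 * (κ + 1) ≤ q ^ 9 := by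
    calc q ^ 3 * (κ + 1) ≤ q ^ 3 * q ^ 6 := Nat.mul_le_mul_left _ (by
          calc κ + 1 ≤ q := by omega
            _ ≤ q ^ 6 := Nat.le_self_pow (by norm_num) q)
      _ = q ^ 9 := by ring
  have hva' : q ^ 3 < q ^ 9 := Nat.pow_lt_pow_right hq1 (by norm_num)
  have hκq' : (κ : ℝ) ≤ q := by linarith
  have hD : ((2 * q ^ 10 * (κ ^ 2 * q ^ 10) : ℕ) : ℝ) ≤ 2 * (q : ℝ) ^ 22 := by
    push_cast
    calc 2 * (q : ℝ) ^ 10 * (κ ^ 2 * q ^ 10) ≤ 2 * (q : ℝ) ^ 10 * (q ^ 2 * q ^ 10) := by gcongr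
      _ = 2 * (q : ℝ) ^ 22 := by ring
  have hcube : 23 * q + 4 ≤ q ^ 3 := by nlinarith [Nat.mul_le_mul hq hq]
  have hsmall : 16 * (q : ℝ) ^ 23 * (1 / 2) ^ q ^ 3 ≤ 1 := by
    rw [one_div, inv_pow, ← div_eq_mul_inv, div_le_one (by positivity)]
    calc 16 * (q : ℝ) ^ 23 ≤ 2 ^ 4 * 2 ^ (23 * q) :=
          mul_le_mul (by norm_num) (hpow2 23) (by positivity) (by positivity)
      _ = 2 ^ (23 * q + 4) := by rw [← pow_add, add_comm]
      _ ≤ 2 ^ q ^ 3 := pow_le_pow_right₀ one_le_two hcube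
  have hpD : 8 * (1 / 2 : ℝ) ^ q ^ 9 * ((2 * q ^ 10 * (κ ^ 2 * q ^ 10) : ℕ) : ℝ) ≤ 1 := by
    calc 8 * (1 / 2 : ℝ) ^ q ^ 9 * ((2 * q ^ 10 * (κ ^ 2 * q ^ 10) : ℕ) : ℝ)
        ≤ 8 * (1 / 2 : ℝ) ^ q ^ 3 * (2 * (q : ℝ) ^ 23) := by
          refine mul_le_mul (mul_le_mul_of_nonneg_left (pow_le_pow_of_le_one (by norm_num)
            (by norm_num) hva'.le) (by norm_num)) (hD.trans ?_) (by positivity) (by positivity)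
          gcongr
          · linarith
          · norm_num
      _ = 16 * (q : ℝ) ^ 23 * (1 / 2) ^ q ^ 3 := by ring
      _ ≤ 1 := hsmall
  have hμ := sum_half_pow_le hκ t ht.read h
  set μ := ∑ j, (1 / 2 : ℝ) ^ (t j).vars.card with hμdef
  have hμ0 : 0 ≤ μ := Finset.sum_nonneg fun j _ => by positivity
  have hr0 : 0 ≤ r := by
    have : 0 ≤ κ * r := hμ0.trans hμ
    exact nonneg_of_mul_nonneg_right this hκ0
  have hEX : ∑ m, 𝔼 x, freshInd t (q ^ 3) m x ≤ 2 * r := by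
    have h1 := sum_expect_fresh_le ht hκ hva hva' hpD h
    have h2 : 2 * (((2 * q ^ 10 * (κ ^ 2 * q ^ 10) : ℕ) : ℝ) * (1 / 2) ^ q ^ 3) * μ ≤ r := by
      calc 2 * (((2 * q ^ 10 * (κ ^ 2 * q ^ 10) : ℕ) : ℝ) * (1 / 2) ^ q ^ 3) * μ
          ≤ 2 * ((2 * (q : ℝ) ^ 22) * (1 / 2) ^ q ^ 3) * (q * r) := by
            gcongr
            exact hμ.trans (mul_le_mul_of_nonneg_right hκq' hr0)
        _ = (16 * (q : ℝ) ^ 23 * (1 / 2) ^ q ^ 3) * (r / 4) := by ring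
        _ ≤ 1 * (r / 4) := mul_le_mul_of_nonneg_right hsmall (by linarith)
        _ ≤ r := by linarith
    linarith
  have hθ : 2 * κ * Real.log (1 + 63) / ((q ^ 9 : ℕ) : ℝ) + κ ^ 2 * ((q ^ 10 : ℕ) : ℝ) *
      (63 * Real.exp (-(((q ^ 9 : ℕ) : ℝ) / (4 * κ)))) ≤ 1 / (q : ℝ) ^ 8 := by
    have hlog : Real.log (1 + 63) ≤ 5 := by
      rw [show (1 + 63 : ℝ) = 2 ^ 6 by norm_num, Real.log_pow]
      have := Real.log_two_lt_d9
      push_cast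
      linarith
    have h1 : 2 * κ * Real.log (1 + 63) / ((q ^ 9 : ℕ) : ℝ) ≤ 1 / 2 / (q : ℝ) ^ 8 := by
      push_cast
      rw [div_le_div_iff₀ (by positivity) (by positivity)]
      calc 2 * κ * Real.log (1 + 63) * (q : ℝ) ^ 8 ≤ 2 * κ * 5 * (q : ℝ) ^ 8 := by gcongr
        _ ≤ (1 / 2 * q) * (q : ℝ) ^ 8 :=
            mul_le_mul_of_nonneg_right (by linarith) (by positivity)
        _ = _ := by ring
    have h2 : κ ^ 2 * ((q ^ 10 : ℕ) : ℝ) * (63 * Real.exp (-(((q ^ 9 : ℕ) : ℝ) / (4 * κ)))) ≤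
        1 / 2 / (q : ℝ) ^ 8 := by
      have hx : (5 : ℝ) * q ^ 8 ≤ ((q ^ 9 : ℕ) : ℝ) / (4 * κ) := by
        push_cast
        rw [le_div_iff₀ (by positivity)]
        calc 5 * (q : ℝ) ^ 8 * (4 * κ) = (20 * κ) * (q : ℝ) ^ 8 := by ring
          _ ≤ q * (q : ℝ) ^ 8 := by gcongr
          _ = (q : ℝ) ^ 9 := by ring
      have he : 126 * (q : ℝ) ^ 20 ≤ Real.exp (((q ^ 9 : ℕ) : ℝ) / (4 * κ)) := by
        calc 126 * (q : ℝ) ^ 20 ≤ (q : ℝ) ^ 4 * q ^ 20 := by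
              gcongr
              calc (126 : ℝ) ≤ 4000 ^ 4 := by norm_num
                _ ≤ (q : ℝ) ^ 4 := by gcongr
          _ ≤ (5 * (q : ℝ) ^ 8) ^ 3 / Nat.factorial 3 := by
              rw [show Nat.factorial 3 = 6 from rfl]
              push_cast
              nlinarith [pow_pos hq0 24]
          _ ≤ Real.exp (5 * (q : ℝ) ^ 8) := Real.pow_div_factorial_le_exp _ (by positivity) 3
          _ ≤ _ := Real.exp_le_exp.2 hx
      rw [Real.exp_neg, ← div_eq_mul_inv, mul_div_assoc', div_le_div_iff₀ (Real.exp_pos _)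
        (by positivity)]
      push_cast at he ⊢
      calc (κ : ℝ) ^ 2 * q ^ 10 * 63 * q ^ 8 ≤ (q : ℝ) ^ 2 * q ^ 10 * 63 * q ^ 8 := by gcongr
        _ = 1 / 2 * (126 * (q : ℝ) ^ 20) := by ring
        _ ≤ _ := by gcongr
    calc _ ≤ 1 / 2 / (q : ℝ) ^ 8 + 1 / 2 / (q : ℝ) ^ 8 := add_le_add h1 h2
      _ = _ := by ring
  have hθ1 : 1 / (q : ℝ) ^ 8 ≤ 1 / 16 := by
    refine one_div_le_one_div_of_le (by norm_num) ?_
    calc (16 : ℝ) ≤ 4000 ^ 8 := by norm_num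
      _ ≤ (q : ℝ) ^ 8 := by gcongr
  refine (expect_prod_one_add_fresh_le ht hκ (by positivity) hva hva' (by norm_num) hθ hθ1
    Finset.univ).trans (Real.exp_le_exp.2 ?_)
  rw [Finset.sum_add_distrib, ← Finset.sum_mul, ← hμdef]
  have herr : μ * Real.exp (3 * (1 / (q : ℝ) ^ 8) * ((q ^ 10 : ℕ) : ℝ) - ((q ^ 3 : ℕ) : ℝ) / 8) ≤
      r := by
    have h1 : 3 * (1 / (q : ℝ) ^ 8) * ((q ^ 10 : ℕ) : ℝ) - ((q ^ 3 : ℕ) : ℝ) / 8 ≤ -q := by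
      have : (1 / (q : ℝ) ^ 8) * ((q ^ 10 : ℕ) : ℝ) = q ^ 2 := by
        push_cast
        field_simp
      rw [mul_assoc, this]
      push_cast
      nlinarith [mul_pos hq0 hq0, mul_le_mul_of_nonneg_right hqR (mul_pos hq0 hq0).le]
    have h2 : κ * Real.exp (-(q : ℝ)) ≤ 1 := by
      rw [Real.exp_neg, ← div_eq_mul_inv, div_le_one (Real.exp_pos _)]
      linarith [Real.add_one_le_exp (q : ℝ)]
    calc _ ≤ (κ * r) * Real.exp (-(q : ℝ)) :=
          mul_le_mul hμ (Real.exp_le_exp.2 h1) (Real.exp_pos _).le (by positivity)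
      _ = (κ * Real.exp (-(q : ℝ))) * r := by ring
      _ ≤ 1 * r := mul_le_mul_of_nonneg_right h2 hr0
      _ = r := one_mul r
  linarith

end Wide

/-! ### Truncated inclusion-exclusion -/

/-- The alternating sum of the first `d + 1` binomial coefficients of `y`, by which
inclusion-exclusion truncated at level `d` replaces the indicator of `y = 0`. -/
def altChoose (d y : ℕ) : ℝ := ∑ i ∈ Finset.range (d + 1), (-1) ^ i * (y.choose i : ℝ)

theorem altChoose_eq {d y : ℕ} (h : y ≤ d) : altChoose d y = if y = 0 then 1 else 0 := by
  have h1 : altChoose d y = ∑ i ∈ Finset.range (y + 1), (-1) ^ i * (y.choose i : ℝ) := by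
    symm
    refine Finset.sum_subset (Finset.range_subset_range.2 (by omega)) fun i _ hi => ?_
    rw [Nat.choose_eq_zero_of_lt (by simpa using hi), Nat.cast_zero, mul_zero]
  rw [h1]
  have h2 := Int.alternating_sum_range_choose (n := y)
  exact_mod_cast congrArg (Int.cast : ℤ → ℝ) h2

theorem abs_altChoose_le (d y : ℕ) : |altChoose d y| ≤ 2 ^ y := by
  have h1 : ∑ i ∈ Finset.range (d + 1), y.choose i ≤ 2 ^ y := by
    rw [← Nat.sum_range_choose]
    calc ∑ i ∈ Finset.range (d + 1), y.choose i
        ≤ ∑ i ∈ Finset.range (max d y + 1), y.choose i :=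
          Finset.sum_le_sum_of_subset (Finset.range_subset_range.2 (by omega))
      _ = ∑ i ∈ Finset.range (y + 1), y.choose i := by
          symm
          refine Finset.sum_subset (Finset.range_subset_range.2 (by omega)) fun i _ hi => ?_
          exact Nat.choose_eq_zero_of_lt (by simpa using hi)
  calc |altChoose d y| ≤ ∑ i ∈ Finset.range (d + 1), |(-1) ^ i * (y.choose i : ℝ)| :=
        Finset.abs_sum_le_sum_abs _ _
    _ = ∑ i ∈ Finset.range (d + 1), (y.choose i : ℝ) :=
        Finset.sum_congr rfl fun i _ => by simp [abs_mul]
    _ ≤ 2 ^ y := by exact_mod_cast h1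

/-- The error of the product of two truncations. The first variable may have a much larger
exponential moment than the second one: its moment is only paired with the truncation `d₁`. -/
theorem sq_sub_altChoose_mul_le (d₁ d₂ y₁ y₂ : ℕ) :
    (altChoose d₁ y₁ * altChoose d₂ y₂ - (if y₁ = 0 then 1 else 0) * (if y₂ = 0 then 1 else 0)) ^ 2
      ≤ (1 / 2 : ℝ) ^ d₂ * 64 ^ y₂ + (1 / 2) ^ d₁ * (64 ^ y₁ + 64 ^ y₂) := by
  have hsq : ∀ d y, altChoose d y ^ 2 ≤ 4 ^ y := fun d y => by
    rw [← sq_abs, show (4 : ℝ) = 2 ^ 2 by norm_num, ← pow_mul, mul_comm, pow_mul]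
    exact pow_le_pow_left₀ (abs_nonneg _) (abs_altChoose_le d y) 2
  have hone : ∀ d y : ℕ, d < y → (1 : ℝ) ≤ (1 / 2) ^ d * 2 ^ y := fun d y h => by
    rw [one_div, inv_pow, inv_mul_eq_div, one_le_div (by positivity)]
    exact pow_le_pow_right₀ one_le_two h.le
  have h84 : ∀ y : ℕ, (2 : ℝ) ^ y * 4 ^ y = 8 ^ y := fun y => by rw [← mul_pow]; norm_num
  by_cases h1 : y₁ ≤ d₁
  · rw [altChoose_eq h1]
    by_cases h2 : y₂ ≤ d₂
    · rw [altChoose_eq h2, sub_self, zero_pow two_ne_zero]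
      positivity
    · push Not at h2
      rw [if_neg (by omega : y₂ ≠ 0), mul_zero, sub_zero]
      calc ((if y₁ = 0 then (1 : ℝ) else 0) * altChoose d₂ y₂) ^ 2 ≤ 4 ^ y₂ := by
            split_ifs
            · rw [one_mul]; exact hsq _ _
            · rw [zero_mul, zero_pow two_ne_zero]; positivity
        _ = 1 * 4 ^ y₂ := (one_mul _).symm
        _ ≤ (1 / 2) ^ d₂ * 2 ^ y₂ * 4 ^ y₂ := by gcongr; exact hone _ _ h2
        _ = (1 / 2) ^ d₂ * 8 ^ y₂ := by rw [mul_assoc, h84]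
        _ ≤ (1 / 2) ^ d₂ * 64 ^ y₂ := by gcongr; norm_num
        _ ≤ _ := le_add_of_nonneg_right (by positivity)
  · push Not at h1
    rw [if_neg (by omega : y₁ ≠ 0), zero_mul, sub_zero, mul_pow]
    calc altChoose d₁ y₁ ^ 2 * altChoose d₂ y₂ ^ 2 ≤ 4 ^ y₁ * 4 ^ y₂ :=
          mul_le_mul (hsq _ _) (hsq _ _) (sq_nonneg _) (by positivity)
      _ = 1 * (4 ^ y₁ * 4 ^ y₂) := (one_mul _).symm
      _ ≤ (1 / 2) ^ d₁ * 2 ^ y₁ * (4 ^ y₁ * 4 ^ y₂) := by gcongr; exact hone _ _ h1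
      _ = (1 / 2) ^ d₁ * (8 ^ y₁ * 4 ^ y₂) := by rw [← h84]; ring
      _ ≤ (1 / 2) ^ d₁ * (8 ^ y₁ * 8 ^ y₂) := by gcongr; norm_num
      _ ≤ (1 / 2) ^ d₁ * (64 ^ y₁ + 64 ^ y₂) := by
          have e : ∀ y : ℕ, (64 : ℝ) ^ y = (8 ^ y) ^ 2 := fun y => by
            rw [← pow_mul, mul_comm, pow_mul]; norm_num
          rw [e, e]
          refine mul_le_mul_of_nonneg_left ?_ (by positivity)
          nlinarith [sq_nonneg ((8 : ℝ) ^ y₁ - 8 ^ y₂), sq_nonneg ((8 : ℝ) ^ y₁),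
            sq_nonneg ((8 : ℝ) ^ y₂)]
      _ ≤ _ := le_add_of_nonneg_left (by positivity)

section Trunc

variable {n : ℕ} {ι : Type*} [Fintype ι] {X : ι → Cube n → ℝ}

/-- The number of events with indicators `X` that occur. -/
noncomputable def countOnes (X : ι → Cube n → ℝ) (x : Cube n) : ℕ :=
  open Classical in (Finset.univ.filter fun j => X j x = 1).card

theorem prod_one_add_eq_pow (hX : ∀ j x, X j x = 0 ∨ X j x = 1) (c : ℝ) (x : Cube n) :
    ∏ j, (1 + c * X j x) = (1 + c) ^ countOnes X x := by
  classical
  unfold countOnes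
  rw [← Finset.prod_const, Finset.prod_filter]
  refine Finset.prod_congr (by congr) fun j _ => ?_
  rcases hX j x with h | h <;> simp [h]

theorem prod_one_sub_eq_ite (hX : ∀ j x, X j x = 0 ∨ X j x = 1) (x : Cube n) :
    ∏ j, (1 - X j x) = if countOnes X x = 0 then 1 else 0 := by
  have h := prod_one_add_eq_pow hX (-1) x
  simp only [neg_mul, one_mul, ← sub_eq_add_neg, sub_self, zero_pow_eq] at h
  exact h

theorem altChoose_countOnes (hX : ∀ j x, X j x = 0 ∨ X j x = 1) (d : ℕ) (x : Cube n) :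
    altChoose d (countOnes X x) =
      ∑ J : Finset ι with J.card ≤ d, (-1) ^ J.card * ∏ j ∈ J, X j x := by
  classical
  set S := Finset.univ.filter fun j => X j x = 1 with hS
  have hprod : ∀ J : Finset ι, ∏ j ∈ J, X j x = if J ⊆ S then 1 else 0 := fun J => by
    split_ifs with h
    · exact Finset.prod_eq_one fun j hj => (Finset.mem_filter.1 (h hj)).2
    · obtain ⟨j, hj, hjS⟩ := Finset.not_subset.1 h
      refine Finset.prod_eq_zero hj ((hX j x).resolve_right fun h1 => hjS ?_)
      exact Finset.mem_filter.2 ⟨Finset.mem_univ _, h1⟩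
  have hcount : countOnes X x = S.card := by unfold countOnes; congr
  rw [hcount, altChoose, ← Finset.sum_fiberwise_of_maps_to (t := Finset.range (d + 1))
    (g := Finset.card) (fun J hJ => by
      have := (Finset.mem_filter.1 hJ).2
      exact Finset.mem_range.2 (by omega))]
  refine Finset.sum_congr rfl fun i hi => ?_
  have hi' : i ≤ d := by have := Finset.mem_range.1 hi; omega
  rw [Finset.sum_congr rfl fun J hJ => by
    rw [(Finset.mem_filter.1 hJ).2, hprod], ← Finset.mul_sum, ← Finset.sum_filter,
    Finset.sum_const, nsmul_eq_mul, mul_one, ← Finset.card_powersetCard]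
  congr 3
  ext J
  simp only [Finset.mem_powersetCard, Finset.mem_filter, Finset.mem_univ, true_and]
  constructor
  · rintro ⟨h1, h2⟩; exact ⟨⟨by omega, h2⟩, h1⟩
  · rintro ⟨⟨_, h2⟩, h1⟩; exact ⟨h1, h2⟩

end Trunc

/-- The union of the sets `U j` over the indices `j` listed by `φ`. -/
def listUnion {α ι : Type*} [DecidableEq α] (U : ι → Finset α) {d : ℕ} (φ : Fin d → Option ι) :
    Finset α :=
  Finset.univ.biUnion fun i => (φ i).elim ∅ U

theorem card_listUnion_le {α ι : Type*} [DecidableEq α] {U : ι → Finset α} {u : ℕ}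
    (hU : ∀ j, (U j).card ≤ u) {d : ℕ} (φ : Fin d → Option ι) :
    (listUnion U φ).card ≤ d * u := by
  refine (Finset.card_biUnion_le_card_mul _ _ u fun i _ => ?_).trans (by simp)
  cases φ i with
  | none => simp
  | some j => exact hU j

theorem exists_biUnion_subset_listUnion {α ι : Type*} [DecidableEq α] (U : ι → Finset α) {d : ℕ}
    {J : Finset ι} (hJ : J.card ≤ d) : ∃ φ : Fin d → Option ι, J.biUnion U ⊆ listUnion U φ := by
  let e := J.equivFin
  refine ⟨fun i => if h : i.val < J.card then some (e.symm ⟨i, h⟩) else none, fun x hx => ?_⟩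
  obtain ⟨j, hj, hx⟩ := Finset.mem_biUnion.1 hx
  have hlt := (e ⟨j, hj⟩).2
  refine Finset.mem_biUnion.2 ⟨⟨e ⟨j, hj⟩, by omega⟩, Finset.mem_univ _, ?_⟩
  simpa [hlt] using hx

section Approx

variable {n : ℕ} {ι₁ ι₂ : Type*} [Fintype ι₁] [Fintype ι₂]

/-- The subsets of unions of at most `d₁` of the sets `U₁ j` and at most `d₂` of the sets
`U₂ j`. -/
def coverFamily (U₁ : ι₁ → Finset (Fin n)) (U₂ : ι₂ → Finset (Fin n)) (d₁ d₂ : ℕ) :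
    Finset (Finset (Fin n)) :=
  Finset.univ.biUnion fun p : (Fin d₁ → Option ι₁) × (Fin d₂ → Option ι₂) =>
    (listUnion U₁ p.1 ∪ listUnion U₂ p.2).powerset

theorem card_coverFamily_le {U₁ : ι₁ → Finset (Fin n)} {U₂ : ι₂ → Finset (Fin n)} {u₁ u₂ : ℕ}
    (h₁ : ∀ j, (U₁ j).card ≤ u₁) (h₂ : ∀ j, (U₂ j).card ≤ u₂) (d₁ d₂ : ℕ) :
    (coverFamily U₁ U₂ d₁ d₂).card ≤
      (Fintype.card ι₁ + 1) ^ d₁ * (Fintype.card ι₂ + 1) ^ d₂ * 2 ^ (d₁ * u₁ + d₂ * u₂) := by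
  refine (Finset.card_biUnion_le_card_mul _ _ (2 ^ (d₁ * u₁ + d₂ * u₂)) fun p _ => ?_).trans
    (by simp)
  rw [Finset.card_powerset]
  exact Nat.pow_le_pow_right two_pos ((Finset.card_union_le _ _).trans
    (add_le_add (card_listUnion_le h₁ _) (card_listUnion_le h₂ _)))

/-- A Boolean function that is false exactly when none of the events in two families occurs is
approximated by truncated inclusion-exclusion, whose Fourier support is a `coverFamily`. -/
theorem exists_approx {X₁ : ι₁ → Cube n → ℝ} {X₂ : ι₂ → Cube n → ℝ}
    {U₁ : ι₁ → Finset (Fin n)} {U₂ : ι₂ → Finset (Fin n)}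
    (hX₁ : ∀ j x, X₁ j x = 0 ∨ X₁ j x = 1) (hX₂ : ∀ j x, X₂ j x = 0 ∨ X₂ j x = 1)
    (hU₁ : ∀ j, DependsOn (X₁ j) (U₁ j : Set (Fin n)))
    (hU₂ : ∀ j, DependsOn (X₂ j) (U₂ j : Set (Fin n))) (d₁ d₂ : ℕ) :
    ∃ g : Cube n → ℝ, (∀ S ∉ coverFamily U₁ U₂ d₁ d₂, cubeFourierCoeff g S = 0) ∧
      𝔼 x, ((1 - (∏ j, (1 - X₁ j x)) * ∏ j, (1 - X₂ j x)) - g x) ^ 2 ≤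
        (1 / 2 : ℝ) ^ d₂ * (𝔼 x, ∏ j, (1 + 63 * X₂ j x)) +
          (1 / 2) ^ d₁ * ((𝔼 x, ∏ j, (1 + 63 * X₁ j x)) + 𝔼 x, ∏ j, (1 + 63 * X₂ j x)) := by
  classical
  refine ⟨fun x => 1 - altChoose d₁ (countOnes X₁ x) * altChoose d₂ (countOnes X₂ x),
    fun S hS => ?_, ?_⟩
  · have hS' : ∀ J₁ : Finset ι₁, J₁.card ≤ d₁ → ∀ J₂ : Finset ι₂, J₂.card ≤ d₂ →
        ¬ S ⊆ J₁.biUnion U₁ ∪ J₂.biUnion U₂ := fun J₁ h₁ J₂ h₂ hsub => by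
      obtain ⟨φ₁, hφ₁⟩ := exists_biUnion_subset_listUnion U₁ h₁
      obtain ⟨φ₂, hφ₂⟩ := exists_biUnion_subset_listUnion U₂ h₂
      exact hS (Finset.mem_biUnion.2 ⟨(φ₁, φ₂), Finset.mem_univ _, Finset.mem_powerset.2
        (hsub.trans (Finset.union_subset_union hφ₁ hφ₂))⟩)
    have hone : cubeFourierCoeff (fun _ : Cube n => (1 : ℝ)) S = 0 := by
      refine cubeFourierCoeff_eq_zero (V := ∅) (fun _ _ _ => rfl) fun h => ?_
      exact hS' ∅ (by simp) ∅ (by simp) (h.trans (Finset.empty_subset _))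
    rw [cubeFourierCoeff_sub, hone, zero_sub, neg_eq_zero]
    simp only [altChoose_countOnes hX₁, altChoose_countOnes hX₂, Finset.sum_mul_sum]
    rw [cubeFourierCoeff_sum]
    refine Finset.sum_eq_zero fun J₁ hJ₁ => ?_
    rw [cubeFourierCoeff_sum]
    refine Finset.sum_eq_zero fun J₂ hJ₂ => ?_
    refine cubeFourierCoeff_eq_zero ?_
      (hS' J₁ (Finset.mem_filter.1 hJ₁).2 J₂ (Finset.mem_filter.1 hJ₂).2)
    rw [Finset.coe_union]
    refine dependsOn_mul (fun x y hxy => ?_) (fun x y hxy => ?_)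
    · congr 1
      exact Finset.prod_congr rfl fun j hj => hU₁ j fun i hi =>
        hxy i (Finset.mem_coe.2 (Finset.mem_biUnion.2 ⟨j, hj, hi⟩))
    · congr 1
      exact Finset.prod_congr rfl fun j hj => hU₂ j fun i hi =>
        hxy i (Finset.mem_coe.2 (Finset.mem_biUnion.2 ⟨j, hj, hi⟩))
  · have h63 : (1 + 63 : ℝ) = 64 := by norm_num
    rw [← Finset.expect_add_distrib, Finset.mul_expect, Finset.mul_expect,
      ← Finset.expect_add_distrib]
    refine Finset.expect_le_expect fun x _ => ?_
    rw [prod_one_add_eq_pow hX₁, prod_one_add_eq_pow hX₂, prod_one_sub_eq_ite hX₁,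
      prod_one_sub_eq_ite hX₂, h63]
    refine le_of_eq_of_le ?_ (sq_sub_altChoose_mul_le d₁ d₂ _ _)
    ring

end Approx

/-! ### Concentration with integer parameters -/

section Core

variable {n : ℕ}

/-- Replacing a formula by the disjunction of two families of its terms costs at most the sum of
the indicators of the remaining terms. -/
theorem sq_eval_sub_le (φ : DNF n) (p₁ p₂ : Fin φ.size → Prop) [DecidablePred p₁]
    [DecidablePred p₂] (x : Cube n) :
    (φ.eval x - (1 - (∏ j : {j // p₁ j}, (1 - (φ.term j).ind x)) *
      ∏ j : {j // p₂ j}, (1 - (φ.term j).ind x))) ^ 2 ≤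
      ∑ j with ¬ p₁ j ∧ ¬ p₂ j, (φ.term j).ind x := by
  have hsum0 : 0 ≤ ∑ j with ¬ p₁ j ∧ ¬ p₂ j, (φ.term j).ind x :=
    Finset.sum_nonneg fun j _ => (φ.term j).ind_nonneg x
  unfold DNF.eval
  by_cases h1 : ∃ j, p₁ j ∧ (φ.term j).Sat x
  · obtain ⟨j, hj, hx⟩ := h1
    rw [if_pos ⟨j, hx⟩, Finset.prod_eq_zero (Finset.mem_univ (⟨j, hj⟩ : {j // p₁ j}))
      (by simp [Term.ind, hx])]
    simpa using hsum0
  by_cases h2 : ∃ j, p₂ j ∧ (φ.term j).Sat x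
  · obtain ⟨j, hj, hx⟩ := h2
    rw [if_pos ⟨j, hx⟩, Finset.prod_eq_zero (s := (Finset.univ : Finset {j // p₂ j}))
      (Finset.mem_univ ⟨j, hj⟩) (by simp [Term.ind, hx])]
    simpa using hsum0
  push Not at h1 h2
  rw [Finset.prod_eq_one fun j _ => by simp [Term.ind, h1 j.1 j.2],
    Finset.prod_eq_one fun j _ => by simp [Term.ind, h2 j.1 j.2]]
  split_ifs with h3
  · obtain ⟨j, hj⟩ := h3
    have hmem : j ∈ Finset.univ.filter fun j => ¬ p₁ j ∧ ¬ p₂ j :=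
      Finset.mem_filter.2 ⟨Finset.mem_univ j, fun h => h1 j h hj, fun h => h2 j h hj⟩
    have := Finset.single_le_sum (f := fun j => (φ.term j).ind x)
      (fun j _ => (φ.term j).ind_nonneg x) hmem
    simp only [Term.ind, hj, if_true] at this
    simpa [Term.ind] using this
  · simpa using hsum0

theorem DNF.IsRead.subtype {φ : DNF n} {κ : ℕ} (hr : φ.IsRead κ) (p : Fin φ.size → Prop)
    [DecidablePred p] (i : Fin n) :
    (Finset.univ.filter fun j : {j // p j} => i ∈ (φ.term j).vars).card ≤ κ := by
  refine (Finset.card_le_card_of_injOn Subtype.val (fun j hj => ?_)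
    Subtype.val_injective.injOn).trans (hr i)
  simpa using hj

theorem expect_sq_sub_le (f g h : Cube n → ℝ) :
    𝔼 x, (f x - h x) ^ 2 ≤ 2 * (𝔼 x, (f x - g x) ^ 2) + 2 * 𝔼 x, (g x - h x) ^ 2 := by
  rw [Finset.mul_expect, Finset.mul_expect, ← Finset.expect_add_distrib]
  refine Finset.expect_le_expect fun x _ => ?_
  nlinarith [sq_nonneg (f x - g x - (g x - h x))]

theorem exp_natCast_le (m : ℕ) : Real.exp m ≤ 2 ^ (2 * m) := by
  rw [← Real.exp_one_pow, pow_mul]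
  refine pow_le_pow_left₀ (Real.exp_pos _).le ?_ m
  have := Real.exp_one_lt_d9
  norm_num
  linarith

theorem half_pow_le_exp_neg (m : ℕ) : Real.exp (-m) ≤ (1 / 2 : ℝ) ^ m := by
  rw [Real.exp_neg, ← Real.exp_one_pow, ← inv_pow, one_div]
  refine pow_le_pow_left₀ (by positivity) (inv_anti₀ two_pos ?_) m
  have := Real.exp_one_gt_d9
  linarith

/-- The narrow terms are at most `2 ^ (2 q ^ 9)` in number. -/
theorem card_add_one_le_of_narrow {ι : Type*} [Fintype ι] {t : ι → Term n} {κ q ℓ : ℕ}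
    (hκ : 0 < κ) (hr : ∀ i, (Finset.univ.filter fun j => i ∈ (t j).vars).card ≤ κ)
    (hw : ∀ j, (t j).vars.card < q ^ 9) (hκq : κ ≤ q) (hq : 4000 ≤ q) (hℓ : ℓ ≤ q ^ 10)
    (h : Real.exp (-(ℓ : ℝ)) ≤ 𝔼 x, ∏ j, (1 - (t j).ind x)) :
    Fintype.card ι + 1 ≤ 2 ^ (2 * q ^ 9) := by
  have h1 := sum_half_pow_le hκ t hr h
  have h2 : (Fintype.card ι : ℝ) * (1 / 2) ^ q ^ 9 ≤ κ * ℓ := by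
    refine le_trans ?_ h1
    rw [← Finset.card_univ, ← nsmul_eq_mul, ← Finset.sum_const]
    exact Finset.sum_le_sum fun j _ =>
      pow_le_pow_of_le_one (by norm_num) (by norm_num) (hw j).le
  rw [one_div, inv_pow, ← div_eq_mul_inv, div_le_iff₀ (by positivity)] at h2
  have h3 : Fintype.card ι ≤ κ * ℓ * 2 ^ q ^ 9 := by exact_mod_cast h2
  have h4 : 11 * q + 1 ≤ q ^ 9 := by
    calc 11 * q + 1 ≤ q * q := by nlinarith
      _ = q ^ 2 := by ring
      _ ≤ q ^ 9 := Nat.pow_le_pow_right (by omega) (by norm_num)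
  calc Fintype.card ι + 1 ≤ q * q ^ 10 * 2 ^ q ^ 9 + 1 := by gcongr; exact h3.trans (by gcongr)
    _ ≤ q ^ 11 * 2 ^ q ^ 9 + q ^ 11 * 2 ^ q ^ 9 := by
        have : 0 < q ^ 11 * 2 ^ q ^ 9 := by positivity
        have e : q * q ^ 10 = q ^ 11 := by ring
        rw [e]
        omega
    _ = 2 * q ^ 11 * 2 ^ q ^ 9 := by ring
    _ ≤ 2 * (2 ^ q) ^ 11 * 2 ^ q ^ 9 := by gcongr; exact (Nat.lt_two_pow_self (n := q)).le
    _ = 2 ^ (11 * q + 1) * 2 ^ q ^ 9 := by ring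
    _ ≤ 2 ^ q ^ 9 * 2 ^ q ^ 9 := by gcongr; norm_num
    _ = _ := by rw [← pow_add]; congr 1; ring

/-- Concentration up to `2 ^ (-ℓ)` for a formula with at most `2 ^ (q ^ 10 - ℓ - 4)` terms whose
read number is at most logarithmic in `q`. Terms of width more than `q ^ 10` are dropped, those of
width less than `q ^ 9` are counted directly, and of the remaining ones only the fresh terms are
counted. The truncation level `q ℓ` for the narrow terms exceeds the level `2000 ℓ` for the fresh
ones, but a narrow term costs only `O(q ^ 9)` bits to describe, so that both parts cost
`O(q ^ 10 ℓ)` bits. -/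
theorem exists_concentratedOn_half_pow {κ q ℓ s : ℕ} (φ : DNF n) (hr : φ.IsRead κ) (hκ : 0 < κ)
    (hq : 4000 ≤ q) (hκq : 20 * 64 ^ κ ≤ q) (hℓ : 1 ≤ ℓ) (hs1 : 1 ≤ s) (hsize : φ.size ≤ s)
    (hs : s * 2 ^ (ℓ + 4) ≤ 2 ^ q ^ 10) :
    ∃ F : Finset (Finset (Fin n)), F.card ≤ 2 ^ (6003 * q ^ 10 * ℓ) ∧
      ConcentratedOn ((1 / 2) ^ ℓ) φ.eval F := by
  have hκ64 : κ ≤ 64 ^ κ := (Nat.lt_pow_self (by norm_num)).le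
  have hκR : (0 : ℝ) < κ := by exact_mod_cast hκ
  have hℓW : ℓ + 4 ≤ q ^ 10 := by
    refine (Nat.pow_le_pow_iff_right (by norm_num : 1 < 2)).1 (le_trans ?_ hs)
    exact Nat.le_mul_of_pos_left _ hs1
  set p₁ : Fin φ.size → Prop := fun j => (φ.term j).vars.card < q ^ 9 with hp₁
  set p₂ : Fin φ.size → Prop :=
    fun j => q ^ 9 ≤ (φ.term j).vars.card ∧ (φ.term j).vars.card ≤ q ^ 10 with hp₂
  set t₁ : {j // p₁ j} → Term n := fun j => φ.term j with ht₁
  set t₂ : {j // p₂ j} → Term n := fun j => φ.term j with ht₂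
  have hr₁ := hr.subtype p₁
  have hr₂ := hr.subtype p₂
  -- the part of the formula without its terms of width more than `q ^ 10`
  set f : Cube n → ℝ := fun x => 1 - (∏ j, (1 - (t₁ j).ind x)) * ∏ j, (1 - (t₂ j).ind x) with hf
  have hpow : ∀ m : ℕ, (1 / 2 : ℝ) ^ (ℓ + m) = (1 / 2) ^ ℓ * (1 / 2) ^ m := fun m => pow_add _ _ _
  have h16 : ((1 : ℝ) / 2) ^ 4 = 1 / 16 := by norm_num
  have hl0 : (0 : ℝ) < (1 / 2) ^ ℓ := by positivity
  have hdrop : 𝔼 x, (φ.eval x - f x) ^ 2 ≤ (1 / 2 : ℝ) ^ (ℓ + 4) := by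
    calc 𝔼 x, (φ.eval x - f x) ^ 2
        ≤ 𝔼 x, ∑ j with ¬ p₁ j ∧ ¬ p₂ j, (φ.term j).ind x :=
          Finset.expect_le_expect fun x _ => sq_eval_sub_le φ p₁ p₂ x
      _ = ∑ j with ¬ p₁ j ∧ ¬ p₂ j, (1 / 2 : ℝ) ^ (φ.term j).vars.card := by
          rw [Finset.expect_sum_comm]
          exact Finset.sum_congr rfl fun j _ => Term.expect_ind _
      _ ≤ ∑ j with ¬ p₁ j ∧ ¬ p₂ j, (1 / 2 : ℝ) ^ q ^ 10 := by
          refine Finset.sum_le_sum fun j hj => pow_le_pow_of_le_one (by norm_num) (by norm_num) ?_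
          have h := (Finset.mem_filter.1 hj).2
          simp only [hp₁, hp₂] at h
          omega
      _ ≤ s * (1 / 2 : ℝ) ^ q ^ 10 := by
          rw [Finset.sum_const, nsmul_eq_mul]
          refine mul_le_mul_of_nonneg_right ?_ (by positivity)
          have h1 := (Finset.card_filter_le (Finset.univ : Finset (Fin φ.size))
            fun j => ¬ p₁ j ∧ ¬ p₂ j)
          rw [Finset.card_univ, Fintype.card_fin] at h1
          exact_mod_cast h1.trans hsize
      _ ≤ (1 / 2 : ℝ) ^ (ℓ + 4) := by
          rw [one_div, inv_pow, inv_pow, ← div_eq_mul_inv, ← one_div,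
            div_le_div_iff₀ (by positivity) (by positivity), one_mul]
          exact_mod_cast hs
  by_cases hunsat : 𝔼 x, (∏ j, (1 - (t₁ j).ind x)) * ∏ j, (1 - (t₂ j).ind x) ≤
      (1 / 2 : ℝ) ^ (ℓ + 4)
  · -- the function is nearly the constant `1`
    refine ⟨{∅}, by rw [Finset.card_singleton]; exact Nat.one_le_two_pow,
      concentratedOn_of_approx (g := fun _ => 1) (fun S hS => ?_) ?_⟩
    · refine cubeFourierCoeff_eq_zero (V := ∅) (fun _ _ _ => rfl) fun h => hS ?_
      rw [Finset.subset_empty.1 h]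
      exact Finset.mem_singleton_self _
    · refine (expect_sq_sub_le _ f _).trans ?_
      have h1 : 𝔼 x, (f x - 1) ^ 2 ≤ (1 / 2 : ℝ) ^ (ℓ + 4) := by
        refine le_trans (Finset.expect_le_expect fun x _ => ?_) hunsat
        have ha : ∀ T : Term n, 0 ≤ 1 - T.ind x ∧ 1 - T.ind x ≤ 1 := fun T =>
          ⟨sub_nonneg.2 (T.ind_le_one x), by linarith [T.ind_nonneg x]⟩
        have h01 : 0 ≤ (∏ j, (1 - (t₁ j).ind x)) * ∏ j, (1 - (t₂ j).ind x) :=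
          mul_nonneg (Finset.prod_nonneg fun j _ => (ha _).1)
            (Finset.prod_nonneg fun j _ => (ha _).1)
        have h02 : (∏ j, (1 - (t₁ j).ind x)) * ∏ j, (1 - (t₂ j).ind x) ≤ 1 :=
          mul_le_one₀ (Finset.prod_le_one (fun j _ => (ha _).1) fun j _ => (ha _).2)
            (Finset.prod_nonneg fun j _ => (ha _).1)
            (Finset.prod_le_one (fun j _ => (ha _).1) fun j _ => (ha _).2)
        simp only [hf]
        nlinarith
      rw [hpow, h16] at hdrop h1
      linarith
  push Not at hunsat
  set r : ℕ := ℓ + 4 with hrdef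
  have hr5 : r ≤ 5 * ℓ := by omega
  have hexp := (half_pow_le_exp_neg r).trans hunsat.le
  have h01 : ∀ (T : Term n) x, 0 ≤ 1 - T.ind x ∧ 1 - T.ind x ≤ 1 := fun T x =>
    ⟨sub_nonneg.2 (T.ind_le_one x), by linarith [T.ind_nonneg x]⟩
  have hexp₁ : Real.exp (-(r : ℝ)) ≤ 𝔼 x, ∏ j, (1 - (t₁ j).ind x) :=
    hexp.trans (Finset.expect_le_expect fun x _ => mul_le_of_le_one_right
      (Finset.prod_nonneg fun j _ => (h01 _ x).1)
      (Finset.prod_le_one (fun j _ => (h01 _ x).1) fun j _ => (h01 _ x).2))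
  have hexp₂ : Real.exp (-(r : ℝ)) ≤ 𝔼 x, ∏ j, (1 - (t₂ j).ind x) :=
    hexp.trans (Finset.expect_le_expect fun x _ => mul_le_of_le_one_left
      (Finset.prod_nonneg fun j _ => (h01 _ x).1)
      (Finset.prod_le_one (fun j _ => (h01 _ x).1) fun j _ => (h01 _ x).2))
  have hspread : IsSpread t₂ κ (q ^ 9) (q ^ 10) := ⟨hr₂, fun j => j.2.1, fun j => j.2.2⟩
  have hind : ∀ (T : Term n) x, T.ind x = 0 ∨ T.ind x = 1 := fun T x => by
    unfold Term.ind; split_ifs <;> simp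
  obtain ⟨g, hgF, hfg⟩ := exists_approx (X₁ := fun j => (t₁ j).ind) (X₂ := freshInd t₂ (q ^ 3))
    (fun j x => hind _ x) (freshInd_eq_zero_or_one t₂ _)
    (fun j => (t₁ j).dependsOn_ind) (dependsOn_freshInd t₂ (q ^ 3)) (q * ℓ) (2000 * ℓ)
  refine ⟨_, ?_, concentratedOn_of_approx hgF ?_⟩
  · have hW16 : s * 2 ≤ 2 ^ q ^ 10 := le_trans (Nat.mul_le_mul_left _ (by
      calc 2 = 2 ^ 1 := rfl
        _ ≤ 2 ^ r := Nat.pow_le_pow_right two_pos (by omega))) hs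
    have hva : q ^ 3 * (κ + 1) ≤ q ^ 9 := by
      calc q ^ 3 * (κ + 1) ≤ q ^ 3 * q ^ 6 := Nat.mul_le_mul_left _ (by
            calc κ + 1 ≤ q := by omega
              _ ≤ q ^ 6 := Nat.le_self_pow (by norm_num) q)
        _ = q ^ 9 := by ring
    have hc₁ := card_add_one_le_of_narrow hκ hr₁ (fun j => j.2) (by omega) hq hℓW hexp₁
    have hc₂ : Fintype.card {j // p₂ j} + 1 ≤ 2 ^ q ^ 10 := by
      have h1 := Fintype.card_subtype_le p₂
      rw [Fintype.card_fin] at h1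
      omega
    calc _ ≤ _ := card_coverFamily_le (fun j => j.2.le)
          (card_freshVars_le hr₂ hspread.le_card hspread.card_le hva hκ) _ _
      _ ≤ (2 ^ (2 * q ^ 9)) ^ (q * ℓ) * (2 ^ q ^ 10) ^ (2000 * ℓ) *
            2 ^ (q * ℓ * q ^ 9 + 2000 * ℓ * (2 * q ^ 10)) :=
          Nat.mul_le_mul_right _ (Nat.mul_le_mul (Nat.pow_le_pow_left hc₁ _)
            (Nat.pow_le_pow_left hc₂ _))
      _ = 2 ^ (6003 * q ^ 10 * ℓ) := by
          rw [← pow_mul, ← pow_mul, ← pow_add, ← pow_add]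
          congr 1
          ring
  · have hB₂ : 𝔼 x, ∏ j, (1 + 63 * freshInd t₂ (q ^ 3) j x) ≤ 2 ^ (1890 * ℓ) := by
      refine (expect_prod_one_add_fresh_le_of_unsat hspread hκ (by omega) hq hexp₂).trans ?_
      calc Real.exp (189 * (r : ℝ)) ≤ Real.exp ((945 * ℓ : ℕ) : ℝ) := by
            refine Real.exp_le_exp.2 ?_
            have : 189 * r ≤ 945 * ℓ := by omega
            exact_mod_cast this
        _ ≤ 2 ^ (2 * (945 * ℓ)) := exp_natCast_le _
        _ = 2 ^ (1890 * ℓ) := by congr 1; ring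
    have hB₁ : 𝔼 x, ∏ j, (1 + 63 * (t₁ j).ind x) ≤ 2 ^ (10 * 64 ^ κ * ℓ) := by
      refine (expect_prod_one_add_le hκ t₁ hr₁ (by norm_num)).trans ?_
      have hμ := sum_half_pow_le hκ t₁ hr₁ hexp₁
      calc Real.exp (((1 + 63 : ℝ) ^ κ - 1) / κ * ∑ j, (1 / 2 : ℝ) ^ (t₁ j).vars.card)
          ≤ Real.exp ((64 ^ κ * (5 * ℓ) : ℕ) : ℝ) := by
            refine Real.exp_le_exp.2 ?_
            have h64 : (1 : ℝ) ≤ 64 ^ κ := one_le_pow₀ (by norm_num)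
            calc ((1 + 63 : ℝ) ^ κ - 1) / κ * ∑ j, (1 / 2 : ℝ) ^ (t₁ j).vars.card
                ≤ ((1 + 63 : ℝ) ^ κ - 1) / κ * (κ * r) := by
                  refine mul_le_mul_of_nonneg_left hμ (div_nonneg ?_ hκR.le)
                  norm_num
                  exact h64
              _ = ((64 : ℝ) ^ κ - 1) * r := by norm_num; field_simp
              _ ≤ 64 ^ κ * r := by
                  have : (0 : ℝ) ≤ r := Nat.cast_nonneg r
                  nlinarith
              _ ≤ ((64 ^ κ * (5 * ℓ) : ℕ) : ℝ) := by
                  have : 64 ^ κ * r ≤ 64 ^ κ * (5 * ℓ) := Nat.mul_le_mul_left _ hr5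
                  exact_mod_cast this
        _ ≤ 2 ^ (2 * (64 ^ κ * (5 * ℓ))) := exp_natCast_le _
        _ = _ := by congr 1; ring
    simp only [prod_one_sub_freshInd] at hfg
    have hhalf : ∀ a b c : ℕ, b + c ≤ a → (1 / 2 : ℝ) ^ a * 2 ^ b ≤ (1 / 2) ^ c :=
      fun a b c h => by
        calc (1 / 2 : ℝ) ^ a * 2 ^ b ≤ (1 / 2) ^ (b + c) * 2 ^ b :=
              mul_le_mul_of_nonneg_right (pow_le_pow_of_le_one (by norm_num) (by norm_num) h)
                (by positivity)
          _ = (1 / 2) ^ c := by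
              rw [pow_add, mul_right_comm, ← mul_pow]
              norm_num
    have e1 : (1 / 2 : ℝ) ^ (2000 * ℓ) * 2 ^ (1890 * ℓ) ≤ (1 / 2) ^ (ℓ + 4) :=
      hhalf _ _ _ (by omega)
    have e2 : (1 / 2 : ℝ) ^ (q * ℓ) * 2 ^ (10 * 64 ^ κ * ℓ) ≤ (1 / 2) ^ (ℓ + 4) := by
      refine hhalf _ _ _ ?_
      calc 10 * 64 ^ κ * ℓ + (ℓ + 4) ≤ (10 * 64 ^ κ + 5) * ℓ := by
            rw [add_mul]; omega
        _ ≤ q * ℓ := Nat.mul_le_mul_right _ (by omega)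
    have e3 : (1 / 2 : ℝ) ^ (q * ℓ) * 2 ^ (1890 * ℓ) ≤ (1 / 2) ^ (ℓ + 4) := by
      refine hhalf _ _ _ ?_
      calc 1890 * ℓ + (ℓ + 4) ≤ 4000 * ℓ := by omega
        _ ≤ q * ℓ := Nat.mul_le_mul_right _ hq
    have e4 : 𝔼 x, (f x - g x) ^ 2 ≤ 3 * (1 / 2 : ℝ) ^ (ℓ + 4) := by
      refine hfg.trans ?_
      have i1 := mul_le_mul_of_nonneg_left hB₂ (by positivity : (0 : ℝ) ≤ (1 / 2) ^ (2000 * ℓ))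
      have i2 := mul_le_mul_of_nonneg_left (add_le_add hB₁ hB₂)
        (by positivity : (0 : ℝ) ≤ (1 / 2) ^ (q * ℓ))
      rw [mul_add] at i2
      linarith
    refine (expect_sq_sub_le _ f _).trans ?_
    rw [hpow] at hdrop e4
    rw [h16] at hdrop e4
    linarith

end Core

/-! ### Choice of the parameters -/

/-- The hypothesis on the read number forces `64 ^ (2 k)` to be at most the tenth root of
`log s`. -/
theorem pow_read_le_rpow {s k : ℕ} {L : ℝ} (hs : 4 < s) (hL : Real.logb 2 s ≤ L)
    (hk : (k : ℝ) ≤ 1 / 720 * (Real.logb 2 (Real.logb 2 s) /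
      Real.logb 2 (Real.logb 2 (Real.logb 2 s)))) :
    (64 ^ k : ℝ) ^ 2 ≤ L ^ (1 / 10 : ℝ) := by
  have hs5 : (5 : ℝ) ≤ s := by exact_mod_cast hs
  have hlog5 : (9 / 4 : ℝ) < Real.logb 2 s := by
    rw [Real.lt_logb_iff_rpow_lt one_lt_two (by linarith)]
    refine lt_of_lt_of_le ?_ hs5
    -- `2 ^ 9 < 5 ^ 4`
    refine lt_of_pow_lt_pow_left₀ 4 (by norm_num) ?_
    rw [← Real.rpow_natCast, ← Real.rpow_mul (by norm_num)]
    norm_num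
  set l := Real.logb 2 s with hl
  set u := Real.logb 2 l with hu
  have hu1 : (8 / 7 : ℝ) < u := by
    rw [hu, Real.lt_logb_iff_rpow_lt one_lt_two (by linarith)]
    refine lt_trans ?_ hlog5
    refine lt_of_pow_lt_pow_left₀ 7 (by norm_num) ?_
    rw [← Real.rpow_natCast, ← Real.rpow_mul (by norm_num)]
    norm_num
  have hlogu : (1 / 6 : ℝ) < Real.logb 2 u := by
    rw [Real.lt_logb_iff_rpow_lt one_lt_two (by linarith)]
    refine lt_trans ?_ hu1
    refine lt_of_pow_lt_pow_left₀ 6 (by norm_num) ?_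
    rw [← Real.rpow_natCast, ← Real.rpow_mul (by norm_num)]
    norm_num
  have hl0 : 0 < l := by linarith
  have hku : (12 : ℝ) * k ≤ u * (1 / 10) := by
    have h1 : u / Real.logb 2 u ≤ 6 * u := by
      rw [div_le_iff₀ (by linarith)]
      nlinarith
    linarith
  calc (64 ^ k : ℝ) ^ 2 = (2 : ℝ) ^ ((12 : ℝ) * k) := by
        rw [show (64 : ℝ) = 2 ^ 6 by norm_num, ← pow_mul, ← pow_mul, ← Real.rpow_natCast]
        congr 1
        push_cast
        ring
    _ ≤ (2 : ℝ) ^ (u * (1 / 10)) := Real.rpow_le_rpow_of_exponent_le one_le_two hku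
    _ = l ^ (1 / 10 : ℝ) := by
        rw [Real.rpow_mul zero_le_two, hu, Real.rpow_logb two_pos (by norm_num) hl0]
    _ ≤ L ^ (1 / 10 : ℝ) := Real.rpow_le_rpow hl0.le hL (by norm_num)

theorem DNF.eval_eq_zero_or_one {n : ℕ} (φ : DNF n) (x : Cube n) :
    φ.eval x = 0 ∨ φ.eval x = 1 := by
  unfold DNF.eval; split_ifs <;> simp

/-- For `ε ≥ 1 / 4` at most one coefficient is needed, as the variance of a Boolean function is at
most `1 / 4`. -/
theorem concentratedOnCoeffs_of_large {n : ℕ} (φ : DNF n) {ε M : ℝ} (hε : 1 / 4 ≤ ε) (hM0 : 0 ≤ M)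
    (hM : ε < 1 → 1 ≤ M) : ConcentratedOnCoeffs ε φ.eval M := by
  rcases lt_or_ge ε 1 with h1 | h1
  · refine ⟨{∅}, by simpa using hM h1, concentratedOn_of_approx (g := fun _ => 1 / 2)
      (fun S hS => ?_) ?_⟩
    · refine cubeFourierCoeff_eq_zero (V := ∅) (fun _ _ _ => rfl) fun h => hS ?_
      rw [Finset.subset_empty.1 h]
      exact Finset.mem_singleton_self _
    · refine (Finset.expect_le Finset.univ_nonempty fun x _ => ?_).trans hε
      rcases φ.eval_eq_zero_or_one x with h | h <;> rw [h] <;> norm_num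
  · refine ⟨∅, by simpa using hM0, concentratedOn_of_approx (g := fun _ => 0)
      (fun S _ => by simp [cubeFourierCoeff]) ?_⟩
    refine (Finset.expect_le Finset.univ_nonempty fun x _ => ?_).trans h1
    rcases φ.eval_eq_zero_or_one x with h | h <;> rw [h] <;> norm_num

end BooleanFourier

theorem theorem2 :
    ∃ c > (0 : ℝ), ∃ C > (0 : ℝ),
      ∀ (n s k : ℕ) (φ : BooleanFourier.DNF n) (ε : ℝ),
        4 < s → 0 < ε → φ.size ≤ s → φ.IsRead k →
        (k : ℝ) ≤ c * (Real.logb 2 (Real.logb 2 s) /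
          Real.logb 2 (Real.logb 2 (Real.logb 2 s))) →
        BooleanFourier.ConcentratedOnCoeffs ε φ.eval
          (((s : ℝ) / ε) ^ (C * Real.logb 2 (1 / ε))) := by
  refine ⟨1 / 720, by norm_num, 12006 * (1638402 : ℝ) ^ 10, by positivity, ?_⟩
  intro n s k φ ε hs hε hsize hr hk
  have hs5 : (5 : ℝ) ≤ s := by exact_mod_cast hs
  have hsε0 : 0 < (s : ℝ) / ε := div_pos (by linarith) hε
  rcases le_or_gt (1 / 4) ε with hε4 | hε4
  · refine BooleanFourier.concentratedOnCoeffs_of_large φ hε4 (Real.rpow_nonneg hsε0.le _)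
      fun hε1 => Real.one_le_rpow ?_ ?_
    · rw [le_div_iff₀ hε]
      linarith
    · have : 0 ≤ Real.logb 2 (1 / ε) := Real.logb_nonneg one_lt_two (by
        rw [le_div_iff₀ hε]
        linarith)
      positivity
  set L := Real.logb 2 (s / ε) with hL
  set b := Real.logb 2 (1 / ε) with hb
  have hb2 : 2 < b := by
    rw [hb, Real.lt_logb_iff_rpow_lt one_lt_two (by positivity), lt_div_iff₀ hε]
    norm_num
    linarith
  have hLb : L = Real.logb 2 s + b := by
    rw [hL, hb, ← Real.logb_mul (by linarith) (by positivity), mul_one_div]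
  have hlogs : 0 ≤ Real.logb 2 s := Real.logb_nonneg one_lt_two (by linarith)
  have hL2 : 2 < L := by linarith
  set y := L ^ (1 / 10 : ℝ) with hy
  have hy1 : 1 ≤ y := Real.one_le_rpow (by linarith) (by norm_num)
  have hy10 : y ^ 10 = L := by
    rw [hy, ← Real.rpow_natCast, ← Real.rpow_mul (by linarith)]
    norm_num
  -- `1638400 = (20 * 64) ^ 2`
  set q : ℕ := ⌈y⌉₊ + 1638400 with hq
  set ℓ : ℕ := ⌈b⌉₊ with hℓ
  have hqlow : y + 1638400 ≤ q := by
    rw [hq]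
    push_cast
    linarith [Nat.le_ceil y]
  have hqup : (q : ℝ) ≤ 1638402 * y := by
    rw [hq]
    push_cast
    linarith [Nat.ceil_lt_add_one (by linarith : 0 ≤ y)]
  have hℓlow : b ≤ ℓ := Nat.le_ceil b
  have hℓup : (ℓ : ℝ) < b + 1 := Nat.ceil_lt_add_one (by linarith)
  have hℓ1 : 1 ≤ ℓ := by
    have : (1 : ℝ) ≤ ℓ := by linarith
    exact_mod_cast this
  have hκq : 20 * 64 ^ (k + 1) ≤ q := by
    have h1 := BooleanFourier.pow_read_le_rpow hs (by linarith : Real.logb 2 s ≤ L) hk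
    rw [← hy] at h1
    have h2 : (20 * 64 ^ (k + 1) : ℝ) ^ 2 ≤ (q : ℝ) ^ 2 := by
      calc (20 * 64 ^ (k + 1) : ℝ) ^ 2 = (1638400 : ℝ) * ((64 : ℝ) ^ k) ^ 2 := by ring
        _ ≤ (q : ℝ) * q :=
            mul_le_mul (by linarith) (by linarith) (by positivity) (Nat.cast_nonneg _)
        _ = (q : ℝ) ^ 2 := (sq _).symm
    have h3 := (pow_le_pow_iff_left₀ (by positivity) (Nat.cast_nonneg q) two_ne_zero).1 h2
    exact_mod_cast h3
  have hpow_b : (2 : ℝ) ^ b = 1 / ε := Real.rpow_logb two_pos (by norm_num) (by positivity)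
  have hpow_L : (2 : ℝ) ^ L = s / ε := Real.rpow_logb two_pos (by norm_num) hsε0
  have hsW : s * 2 ^ (ℓ + 4) ≤ 2 ^ q ^ 10 := by
    have h1 : (s : ℝ) * 2 ^ (ℓ + 4) ≤ 2 ^ q ^ 10 := by
      have hq10 : L + 5 ≤ ((q ^ 10 : ℕ) : ℝ) := by
        push_cast
        calc L + 5 ≤ y ^ 10 + 1638400 ^ 10 := by rw [hy10]; norm_num
          _ ≤ (y + 1638400) ^ 10 := pow_add_pow_le (by linarith) (by norm_num) (by norm_num)
          _ ≤ (q : ℝ) ^ 10 := pow_le_pow_left₀ (by linarith) hqlow 10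
      calc (s : ℝ) * 2 ^ (ℓ + 4) = s * (2 : ℝ) ^ ((ℓ + 4 : ℕ) : ℝ) := by rw [Real.rpow_natCast]
        _ ≤ s * (2 : ℝ) ^ (b + 5) := by
            refine mul_le_mul_of_nonneg_left (Real.rpow_le_rpow_of_exponent_le one_le_two ?_)
              (by linarith)
            push_cast
            linarith
        _ = (2 : ℝ) ^ (L + 5) := by
            rw [Real.rpow_add two_pos, Real.rpow_add two_pos, hpow_b, hpow_L]
            ring
        _ ≤ (2 : ℝ) ^ ((q ^ 10 : ℕ) : ℝ) := Real.rpow_le_rpow_of_exponent_le one_le_two hq10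
        _ = 2 ^ q ^ 10 := Real.rpow_natCast _ _
    exact_mod_cast h1
  obtain ⟨F, hF, hconc⟩ := BooleanFourier.exists_concentratedOn_half_pow φ
    (fun i => (hr i).trans (Nat.le_succ k)) (Nat.succ_pos k) (by omega) hκq hℓ1 (by omega) hsize hsW
  refine ⟨F, ?_, hconc.trans ?_⟩
  · calc (F.card : ℝ) ≤ (2 : ℝ) ^ (6003 * q ^ 10 * ℓ) := by exact_mod_cast hF
      _ = (2 : ℝ) ^ ((6003 * q ^ 10 * ℓ : ℕ) : ℝ) := (Real.rpow_natCast _ _).symm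
      _ ≤ (2 : ℝ) ^ (L * (12006 * 1638402 ^ 10 * b)) := by
          refine Real.rpow_le_rpow_of_exponent_le one_le_two ?_
          have h1 : (q : ℝ) ^ 10 ≤ 1638402 ^ 10 * L := by
            rw [← hy10, ← mul_pow]
            exact pow_le_pow_left₀ (Nat.cast_nonneg q) hqup 10
          have h2 : (ℓ : ℝ) ≤ 2 * b := by linarith
          push_cast
          calc 6003 * (q : ℝ) ^ 10 * ℓ ≤ 6003 * (1638402 ^ 10 * L) * (2 * b) := by
                refine mul_le_mul (mul_le_mul_of_nonneg_left h1 (by norm_num)) h2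
                  (Nat.cast_nonneg _) (by positivity)
            _ = L * (12006 * 1638402 ^ 10 * b) := by ring
      _ = ((s : ℝ) / ε) ^ (12006 * 1638402 ^ 10 * b) := by
          rw [Real.rpow_mul zero_le_two, hpow_L]
  · calc (1 / 2 : ℝ) ^ ℓ = 1 / 2 ^ ℓ := one_div_pow 2 ℓ
      _ = 1 / (2 : ℝ) ^ (ℓ : ℝ) := by rw [Real.rpow_natCast]
      _ ≤ 1 / (2 : ℝ) ^ b := one_div_le_one_div_of_le (Real.rpow_pos_of_pos two_pos _)
          (Real.rpow_le_rpow_of_exponent_le one_le_two hℓlow)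
      _ = ε := by rw [hpow_b, one_div_one_div]
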